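/- For every $r\ge 0$ and every non-trivial word $w$ in the free group $F_r$ on $r$ generators there exist constants $C,\alpha,\epsilon>0$, depending only on $w$, such that the following holds for every $n$. Let $\mathrm{U}_n$ be the group of unitary $n\times n$ complex matrices, let $\mathsf{G}_1,\dots,\mathsf{G}_r$ be independent random elements of $\mathrm{U}_n$, each distributed according to the Haar probability measure, and let $w(\mathsf{G}_1,\dots,\mathsf{G}_r)\in\mathrm{U}_n$ be obtained by substituting $\mathsf{G}_i$ for the $i$-th generator in $w$. Let $\rho\in\mathrm{Irr}(\mathrm{U}_n)$, i.e. let $\rho:\mathrm{U}_n\to\mathbb{C}$ be the character of a continuous irreducible finite-dimensional complex representation of $\mathrm{U}_n$, and let $\rho(1)$ denote its degree, the dimension of that representation. If $\rho(1)\le 2^{Cn^{\alpha}}$, then \[ \left|\mathbb{E}\bigl(\rho(w(\mathsf{G}_1,\dots,\mathsf{G}_r))\bigr)\right|\le \rho(1)^{1-\epsilon}. \] -/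

import Mathlib

/-!
An irreducible representation of `U_n` of dimension at most `2 ^ (C * n ^ α)` has few weights.
A weight taking many different values has a large orbit under permutations, and one with two values
far apart starts a long root string, so every weight agrees with a common constant `b` outside a
few places. After a twist by `det ^ (-b)` the matrix coefficients are polynomials of low degree in
the entries and their conjugates, and permuting a weight shows that the dimension is at least
`n.choose K`, where `K` is that degree.

By Schur averaging such a representation embeds in a mixed tensor power of `ℂⁿ`. Conjugation by
diagonal matrices then shows that only terms whose indices all repeat contribute to the trace, so
its absolute value is at most a sum of about `n ^ k` products of `k ≤ K` entries of the word. The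
moments of the entries of the word are bounded by expanding over paths: invariance of the Haar
measure under diagonal matrices and reducedness of the word kill every path with a vertex visited
only once, and `E |u i j| ^ (2 * D) ≤ D! / n ^ D`. Altogether the expectation is at most
`(√n * N ^ (3 * L + 7)) ^ K`, with `N` polynomial in `K` and `L + 1` the length of the word, which
is a power less than one of `n.choose K`.
-/

open MeasureTheory

/-- The group `U_n` of unitary `n × n` complex matrices, with the topology induced from the
space of matrices. -/
abbrev UnitaryGrp (n : ℕ) : Type := Matrix.unitaryGroup (Fin n) ℂ

noncomputable instance UnitaryGrp.measurableSpace (n : ℕ) : MeasurableSpace (UnitaryGrp n) :=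
  borel (UnitaryGrp n)

instance UnitaryGrp.borelSpace (n : ℕ) : BorelSpace (UnitaryGrp n) := ⟨rfl⟩

instance UnitaryGrp.compactSpace (n : ℕ) : CompactSpace (UnitaryGrp n) := by
  have hK : IsCompact (Set.univ.pi fun _ : Fin n => Set.univ.pi fun _ : Fin n =>
      Metric.closedBall (0 : ℂ) 1) :=
    isCompact_univ_pi fun _ => isCompact_univ_pi fun _ => isCompact_closedBall _ _
  have hc : IsClosed (Matrix.unitaryGroup (Fin n) ℂ : Set (Matrix (Fin n) (Fin n) ℂ)) :=
    isClosed_unitary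
  refine isCompact_iff_compactSpace.mp (hK.of_isClosed_subset hc ?_)
  intro A hA i _ j _
  simpa using entry_norm_bound_of_unitary hA i j

/-- The Haar probability measure of `U_n`. -/
noncomputable def unitaryHaar (n : ℕ) : Measure (UnitaryGrp n) := Measure.haarMeasure ⊤

instance unitaryHaar.isHaarMeasure (n : ℕ) : (unitaryHaar n).IsHaarMeasure := by
  unfold unitaryHaar; infer_instance

instance unitaryHaar.isProbabilityMeasure (n : ℕ) : IsProbabilityMeasure (unitaryHaar n) :=
  ⟨by simpa [unitaryHaar] using
    Measure.haarMeasure_self (K₀ := (⊤ : TopologicalSpace.PositiveCompacts (UnitaryGrp n)))⟩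

/-- `Irr(G)`: the characters of the continuous irreducible finite-dimensional complex
representations of a topological group `G`. After a choice of basis, the representation space
is `ℂ^d`. -/
def Irr (G : Type*) [Group G] [TopologicalSpace G] : Set (G → ℂ) :=
  {χ | ∃ (d : ℕ) (π : Representation ℂ G (Fin d → ℂ)),
    (∀ v : Fin d → ℂ, Continuous fun g => π g v) ∧ π.IsIrreducible ∧ π.character = χ}

/-- `w_G(g_1, …, g_r)`: the element of `G` obtained from the word `w` by substituting `g_i`
for the `i`-th free generator. -/
def wordMap {r : ℕ} (w : FreeGroup (Fin r)) {G : Type*} [Group G] (g : Fin r → G) : G :=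
  FreeGroup.lift g w

/-- `E(f(w(G_1, …, G_r)))`, for independent Haar-distributed random elements `G_1, …, G_r`
of `U_n`, whose joint law is the product measure. -/
noncomputable def wordExpectation {r : ℕ} (w : FreeGroup (Fin r)) (n : ℕ)
    (f : UnitaryGrp n → ℂ) : ℂ :=
  ∫ g : Fin r → UnitaryGrp n, f (wordMap w g) ∂(Measure.pi fun _ => unitaryHaar n)

theorem integrable_of_continuous {X E : Type*} [TopologicalSpace X] [CompactSpace X]
    [MeasurableSpace X] [OpensMeasurableSpace X] {μ : Measure X} [IsFiniteMeasureOnCompacts μ]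
    [NormedAddCommGroup E] {f : X → E} (hf : Continuous f) : Integrable f μ :=
  hf.integrable_of_hasCompactSupport (HasCompactSupport.of_compactSpace f)

theorem continuous_integral_continuousMap {X : Type*} [TopologicalSpace X] [CompactSpace X]
    [MeasurableSpace X] [OpensMeasurableSpace X] (μ : Measure X) [IsFiniteMeasure μ] :
    Continuous fun f : C(X, ℂ) => ∫ x, f x ∂μ := by
  refine (LipschitzWith.of_dist_le' (K := μ.real Set.univ) fun f g => ?_).continuous
  rw [dist_eq_norm, ← integral_sub (integrable_of_continuous (map_continuous f))
    (integrable_of_continuous (map_continuous g)), mul_comm]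
  exact norm_integral_le_of_norm_le_const (.of_forall fun x => by
    rw [← dist_eq_norm]
    exact ContinuousMap.dist_apply_le_dist x)

theorem prod_le_sum_pow_card_div_card {ι : Type*} {s : Finset ι} (hs : s.Nonempty) {x : ι → ℝ}
    (hx : ∀ i ∈ s, 0 ≤ x i) : ∏ i ∈ s, x i ≤ (∑ i ∈ s, x i ^ s.card) / s.card := by
  have hcard : (s.card : ℝ) ≠ 0 := by exact_mod_cast hs.card_pos.ne'
  have h := Real.geom_mean_le_arith_mean_weighted s (fun _ => (s.card : ℝ)⁻¹)
    (fun i => x i ^ s.card) (fun _ _ => by positivity)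
    (by rw [Finset.sum_const, nsmul_eq_mul, mul_inv_cancel₀ hcard])
    (fun i hi => pow_nonneg (hx i hi) _)
  rw [← Finset.mul_sum, inv_mul_eq_div] at h
  refine le_trans (le_of_eq (Finset.prod_congr rfl fun i hi => ?_)) h
  rw [Real.pow_rpow_inv_natCast (hx i hi) hs.card_pos.ne']

theorem integral_prod_le_of_integral_pow_card_le {Ω ι : Type*} [MeasurableSpace Ω]
    {μ : Measure Ω} [Fintype ι] [Nonempty ι] {f : ι → Ω → ℝ} (hf : ∀ i ω, 0 ≤ f i ω)
    (hint : ∀ i, Integrable (fun ω => f i ω ^ Fintype.card ι) μ) {B : ℝ}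
    (hB : ∀ i, ∫ ω, f i ω ^ Fintype.card ι ∂μ ≤ B) : ∫ ω, ∏ i, f i ω ∂μ ≤ B := by
  have hcard : (Fintype.card ι : ℝ) ≠ 0 := by exact_mod_cast Fintype.card_ne_zero
  calc ∫ ω, ∏ i, f i ω ∂μ ≤ ∫ ω, (∑ i, f i ω ^ Fintype.card ι) / Fintype.card ι ∂μ :=
        integral_mono_of_nonneg (.of_forall fun ω => Finset.prod_nonneg fun i _ => hf i ω)
          ((integrable_finsetSum _ fun i _ => hint i).div_const _) (.of_forall fun ω =>
            prod_le_sum_pow_card_div_card Finset.univ_nonempty fun i _ => hf i ω)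
    _ = (∑ i, ∫ ω, f i ω ^ Fintype.card ι ∂μ) / Fintype.card ι := by
        rw [integral_div, integral_finsetSum _ fun i _ => hint i]
    _ ≤ (∑ _i : ι, B) / Fintype.card ι := by gcongr with i; exact hB i
    _ = B := by
        rw [Finset.sum_const, Finset.card_univ, nsmul_eq_mul, mul_div_cancel_left₀ _ hcard]

theorem exists_perm_comp_eq_iff_card_fiber_eq {α β : Type*} [Fintype α] [DecidableEq β]
    {f g : α → β} : (∃ σ : Equiv.Perm α, f ∘ σ = g) ↔
      ∀ b, Fintype.card {a // f a = b} = Fintype.card {a // g a = b} := by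
  constructor
  · rintro ⟨σ, rfl⟩ b
    exact (Fintype.card_congr (σ.subtypeEquiv fun _ => Iff.rfl)).symm
  · intro h
    exact ⟨Equiv.ofFiberEquiv fun b => Fintype.equivOfCardEq (h b).symm,
      funext fun a => Equiv.ofFiberEquiv_map _ a⟩

theorem card_filter_exists_perm_comp_eq_le {D : ℕ} {β : Type*} [Fintype β] [DecidableEq β]
    (f : Fin D → β) :
    (Finset.univ.filter fun g => ∃ σ : Equiv.Perm (Fin D), f ∘ σ = g).card ≤ D.factorial := by
  have hsub : (Finset.univ.filter fun g => ∃ σ : Equiv.Perm (Fin D), f ∘ σ = g) ⊆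
      Finset.univ.image fun σ : Equiv.Perm (Fin D) => f ∘ σ := fun g hg => by
    simpa using hg
  refine (Finset.card_le_card hsub).trans (Finset.card_image_le.trans_eq ?_)
  rw [Finset.card_univ, Fintype.card_perm, Fintype.card_fin]

theorem exp_one_zpow_injective : Function.Injective fun m : ℤ => Circle.exp 1 ^ m := by
  intro a b h
  simp only [← Circle.exp_intCast_mul, mul_one] at h
  obtain ⟨m, hm⟩ := Circle.exp_eq_exp.mp h
  rcases eq_or_ne m 0 with rfl | hm0
  · simpa using hm
  · refine absurd (?_ : (((a - b : ℤ) / (2 * m : ℤ) : ℚ) : ℝ) = Real.pi)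
      (irrational_pi.ne_rat _).symm
    have : (m : ℝ) ≠ 0 := by exact_mod_cast hm0
    push_cast
    field_simp
    linarith

/-! ### The unitary group -/

namespace UnitaryGrp

variable {n : ℕ}

instance secondCountableTopology : SecondCountableTopology (UnitaryGrp n) := by
  have : SecondCountableTopology (Matrix (Fin n) (Fin n) ℂ) :=
    inferInstanceAs (SecondCountableTopology (Fin n → Fin n → ℂ))
  exact TopologicalSpace.Subtype.secondCountableTopology _

theorem continuous_apply (i j : Fin n) : Continuous fun u : UnitaryGrp n => u i j :=
  continuous_subtype_val.matrix_elem i j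

theorem inv_apply (u : UnitaryGrp n) (i j : Fin n) : u⁻¹ i j = star (u j i) := rfl

theorem sum_norm_sq_col (u : UnitaryGrp n) (j : Fin n) : ∑ i, ‖u i j‖ ^ 2 = 1 := by
  have h := congrFun (congrFun (Matrix.UnitaryGroup.star_mul_self u) j) j
  simp only [Matrix.mul_apply, Matrix.star_apply, Complex.star_def, Complex.conj_mul',
    Matrix.one_apply_eq] at h
  exact_mod_cast h

/-- The embedding of the diagonal torus in the unitary group. -/
noncomputable def diagonal : (Fin n → Circle) →* UnitaryGrp n where
  toFun t := ⟨Matrix.diagonal fun i => (t i : ℂ), by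
    simp [Matrix.mem_unitaryGroup_iff, Matrix.star_eq_conjTranspose, Complex.mul_conj]⟩
  map_one' := Subtype.ext (by simp)
  map_mul' s t := Subtype.ext (by simp)

theorem diagonal_apply (t : Fin n → Circle) (i j : Fin n) :
    diagonal t i j = if i = j then (t i : ℂ) else 0 :=
  Matrix.diagonal_apply ..

theorem diagonal_mul_apply (t : Fin n → Circle) (u : UnitaryGrp n) (i j : Fin n) :
    (diagonal t * u) i j = t i * u i j :=
  Matrix.diagonal_mul ..

theorem mul_diagonal_apply (t : Fin n → Circle) (u : UnitaryGrp n) (i j : Fin n) :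
    (u * diagonal t) i j = u i j * t j :=
  Matrix.mul_diagonal ..

theorem exists_row_eq {v : EuclideanSpace ℂ (Fin n)} (hv : ‖v‖ = 1) (i : Fin n) :
    ∃ u : UnitaryGrp n, ∀ j, u i j = v j := by
  have horth : Orthonormal ℂ (({i} : Set (Fin n)).domRestrict fun _ => v) :=
    ⟨fun _ => hv, fun a b hab => absurd (Subsingleton.elim a b) hab⟩
  obtain ⟨b, hb⟩ := horth.exists_orthonormalBasis_extension_of_card_eq (by simp)
  refine ⟨⟨_, Matrix.transpose_mem_unitaryGroup_iff.mpr
    ((EuclideanSpace.basisFun (Fin n) ℂ).toMatrix_orthonormalBasis_mem_unitary b)⟩, fun j => ?_⟩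
  change (EuclideanSpace.basisFun (Fin n) ℂ).toBasis.toMatrix b j i = v j
  simp [Module.Basis.toMatrix_apply, hb i rfl]

theorem exists_row_eq_inv_sqrt (i : Fin n) :
    ∃ u : UnitaryGrp n, ∀ j, u i j = ((√n : ℝ) : ℂ)⁻¹ := by
  have hn : (0 : ℝ) < n := by exact_mod_cast i.pos
  refine exists_row_eq (v := WithLp.toLp 2 fun _ => ((√n : ℝ) : ℂ)⁻¹) ?_ i
  simp [EuclideanSpace.norm_eq, hn.ne']

/-! ### Moments of the entries of a Haar unitary -/

theorem integral_prod_mul_star_prod_eq_zero {D : ℕ} {f g : Fin D → Fin n} (l : Fin n)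
    (h : ¬∃ σ : Equiv.Perm (Fin D), f ∘ σ = g) :
    ∫ u : UnitaryGrp n, (∏ q, u (f q) l) * star (∏ q, u (g q) l) ∂unitaryHaar n = 0 := by
  obtain ⟨v, hv⟩ := not_forall.mp (exists_perm_comp_eq_iff_card_fiber_eq.not.mp h)
  set t : Fin n → Circle := Pi.mulSingle v (Circle.exp 1) with ht
  have hprod (f : Fin D → Fin n) (u : UnitaryGrp n) : ∏ q, (diagonal t * u) (f q) l =
      (Circle.exp 1 ^ Fintype.card {q // f q = v} : Circle) * ∏ q, u (f q) l := by
    have hscalar : ∏ q, t (f q) = Circle.exp 1 ^ Fintype.card {q // f q = v} := by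
      simp only [ht, Pi.mulSingle_apply]
      rw [Finset.prod_ite, Finset.prod_const, Finset.prod_const_one, mul_one, Fintype.card_subtype]
    have hcoe : ((∏ q, t (f q) : Circle) : ℂ) = ∏ q, (t (f q) : ℂ) := map_prod Circle.coeHom ..
    rw [← hscalar, hcoe, ← Finset.prod_mul_distrib]
    exact Finset.prod_congr rfl fun q _ => diagonal_mul_apply ..
  set z : Circle := Circle.exp 1 ^ (Fintype.card {q // f q = v} : ℤ) *
    (Circle.exp 1 ^ (Fintype.card {q // g q = v} : ℤ))⁻¹ with hz
  have hz1 : z ≠ 1 := fun hz1 =>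
    hv (by exact_mod_cast exp_one_zpow_injective (mul_inv_eq_one.mp hz1))
  have hinv := integral_mul_left_eq_self (μ := unitaryHaar n)
    (fun u : UnitaryGrp n => (∏ q, u (f q) l) * star (∏ q, u (g q) l)) (diagonal t)
  have hfactor : ∀ u : UnitaryGrp n,
      (∏ q, (diagonal t * u) (f q) l) * star (∏ q, (diagonal t * u) (g q) l) =
        z * ((∏ q, u (f q) l) * star (∏ q, u (g q) l)) := fun u => by
    rw [hprod, hprod, star_mul', hz, Circle.coe_mul, Circle.coe_inv_eq_conj]
    simp only [zpow_natCast, Complex.star_def]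
    ring
  simp only [hfactor, integral_const_mul] at hinv
  exact (mul_left_eq_self₀.mp hinv).resolve_left fun h => hz1 (Subtype.ext h)

theorem integral_norm_sum_col_pow_eq (D : ℕ) (l : Fin n) :
    ∫ u : UnitaryGrp n, ‖∑ j, u j l‖ ^ (2 * D) ∂unitaryHaar n =
      ∑ f : Fin D → Fin n,
        (Finset.univ.filter fun g => ∃ σ : Equiv.Perm (Fin D), f ∘ σ = g).card *
          ∫ u : UnitaryGrp n, ‖∏ q, u (f q) l‖ ^ 2 ∂unitaryHaar n := by
  let m (f : Fin D → Fin n) (u : UnitaryGrp n) : ℂ := ∏ q, u (f q) l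
  have hm (f) : Continuous (m f) := continuous_finsetProd _ fun q _ => continuous_apply (f q) l
  have hexpand (u : UnitaryGrp n) : ((‖∑ j, u j l‖ ^ (2 * D) : ℝ) : ℂ) =
      ∑ f, ∑ g, m f u * star (m g u) := by
    have hpow : ∑ f, m f u = (∑ j, u j l) ^ D := (Fintype.sum_pow (fun j => u j l) D).symm
    rw [← Finset.sum_mul_sum, ← star_sum, hpow, Complex.star_def, Complex.mul_conj', norm_pow,
      mul_comm 2 D, pow_mul, Complex.ofReal_pow]
  have hint (f g : Fin D → Fin n) : Integrable (fun u => m f u * star (m g u)) (unitaryHaar n) :=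
    integrable_of_continuous ((hm f).mul (hm g).star)
  have hterm (f g : Fin D → Fin n) : ∫ u, m f u * star (m g u) ∂unitaryHaar n =
      if ∃ σ : Equiv.Perm (Fin D), f ∘ σ = g then
        ((∫ u, ‖m f u‖ ^ 2 ∂unitaryHaar n : ℝ) : ℂ) else 0 := by
    split_ifs with h
    · obtain ⟨σ, rfl⟩ := h
      have hperm : m (f ∘ σ) = m f := funext fun u =>
        Equiv.prod_comp σ fun q => u (f q) l
      simp only [hperm, Complex.star_def, Complex.mul_conj', ← Complex.ofReal_pow]
      exact integral_complex_ofReal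
    · exact integral_prod_mul_star_prod_eq_zero l h
  apply Complex.ofReal_injective
  rw [← integral_complex_ofReal]
  simp only [hexpand]
  rw [integral_finsetSum _ fun f _ => integrable_finsetSum _ fun g _ => hint f g]
  push_cast
  refine Finset.sum_congr rfl fun f _ => ?_
  rw [integral_finsetSum _ fun g _ => hint f g]
  simp only [hterm, ← Finset.sum_filter, Finset.sum_const, nsmul_eq_mul]
  rfl

theorem integral_norm_sum_col_pow_le (D : ℕ) (l : Fin n) :
    ∫ u : UnitaryGrp n, ‖∑ j, u j l‖ ^ (2 * D) ∂unitaryHaar n ≤ D.factorial := by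
  have htotal :
      ∑ f : Fin D → Fin n, ∫ u : UnitaryGrp n, ‖∏ q, u (f q) l‖ ^ 2 ∂unitaryHaar n = 1 := by
    have hcol (u : UnitaryGrp n) : ∑ f : Fin D → Fin n, ‖∏ q, u (f q) l‖ ^ 2 = 1 := by
      simp only [norm_prod, ← Finset.prod_pow]
      rw [← Fintype.sum_pow (fun j => ‖u j l‖ ^ 2) D, sum_norm_sq_col, one_pow]
    have hint (f : Fin D → Fin n) :
        Integrable (fun u : UnitaryGrp n => ‖∏ q, u (f q) l‖ ^ 2) (unitaryHaar n) :=
      integrable_of_continuous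
        ((continuous_finsetProd _ fun q _ => continuous_apply (f q) l).norm.pow 2)
    rw [← integral_finsetSum _ fun f _ => hint f]
    simp only [hcol, integral_const, probReal_univ, one_smul]
  rw [integral_norm_sum_col_pow_eq]
  calc _ ≤ ∑ f : Fin D → Fin n,
          (D.factorial : ℝ) * ∫ u : UnitaryGrp n, ‖∏ q, u (f q) l‖ ^ 2 ∂unitaryHaar n := by
        gcongr with f
        exact card_filter_exists_perm_comp_eq_le f
    _ = D.factorial := by rw [← Finset.mul_sum, htotal, mul_one]

theorem integral_norm_entry_pow_le (D : ℕ) (i l : Fin n) :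
    ∫ u : UnitaryGrp n, ‖u i l‖ ^ (2 * D) ∂unitaryHaar n ≤ D.factorial / (n : ℝ) ^ D := by
  obtain ⟨A, hA⟩ := exists_row_eq_inv_sqrt i
  have hentry (u : UnitaryGrp n) :
      ‖(A * u) i l‖ ^ (2 * D) = ‖∑ j, u j l‖ ^ (2 * D) / (n : ℝ) ^ D := by
    rw [Matrix.UnitaryGroup.mul_apply, Matrix.mul_apply]
    simp only [hA, ← Finset.mul_sum]
    rw [norm_mul, norm_inv, Complex.norm_real, Real.norm_of_nonneg (Real.sqrt_nonneg _), mul_pow,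
      inv_pow, pow_mul (√n), Real.sq_sqrt n.cast_nonneg, inv_mul_eq_div]
  rw [← integral_mul_left_eq_self _ A]
  simp only [hentry, integral_div]
  gcongr
  exact integral_norm_sum_col_pow_le D l

end UnitaryGrp

/-! ### Labellings without lonely labels -/

theorem two_mul_card_image_filter_notMem_le {β γ : Type*} [Fintype β] [DecidableEq γ]
    {A : Finset γ} {f : β → γ} (hf : ∀ p, f p ∉ A → ∃ q ≠ p, f q = f p) :
    2 * ((Finset.univ.image f).filter (· ∉ A)).card ≤
      (Finset.univ.filter fun p => f p ∉ A).card := by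
  classical
  refine Finset.mul_card_image_le_card_of_maps_to (f := f) (fun p hp => ?_) 2 fun v hv => ?_
  · simpa using hp
  · obtain ⟨hvf, hvA⟩ := Finset.mem_filter.mp hv
    obtain ⟨p, -, rfl⟩ := Finset.mem_image.mp hvf
    obtain ⟨q, hqp, hq⟩ := hf p hvA
    refine (Finset.card_pair hqp).ge.trans (Finset.card_le_card fun x hx => ?_)
    rcases Finset.mem_insert.mp hx with rfl | hx
    · simpa [hq] using hvA
    · simpa [Finset.mem_singleton.mp hx] using hvA

theorem card_filter_card_image_filter_notMem_le {β γ : Type*} [Fintype β] [DecidableEq β]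
    [Fintype γ] [DecidableEq γ] [Nonempty γ] (A : Finset γ) (m : ℕ) :
    (Finset.univ.filter fun f : β → γ =>
      ((Finset.univ.image f).filter (· ∉ A)).card ≤ m).card ≤
      Fintype.card γ ^ m * (m + A.card) ^ Fintype.card β := by
  let decode (x : (Fin m → γ) × (β → Fin m ⊕ A)) (p : β) : γ :=
    Sum.elim x.1 Subtype.val (x.2 p)
  calc _ ≤ (Finset.univ.image decode).card := by
        refine Finset.card_le_card fun f hf => ?_
        set T := (Finset.univ.image f).filter (· ∉ A) with hT
        obtain ⟨e⟩ := Function.Embedding.nonempty_of_card_le (α := T) (β := Fin m)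
          (by simpa using hf)
        let name : Fin m → γ := Function.extend e Subtype.val fun _ => Classical.arbitrary γ
        have hcode (p : β) : ∃ c : Fin m ⊕ A, Sum.elim name Subtype.val c = f p := by
          by_cases hp : f p ∈ A
          · exact ⟨Sum.inr ⟨f p, hp⟩, rfl⟩
          · have hpT : f p ∈ T := by simp [hT, hp]
            have hname : name (e ⟨f p, hpT⟩) = f p := e.injective.extend_apply ..
            exact ⟨Sum.inl (e ⟨f p, hpT⟩), hname⟩
        choose code hcode using hcode
        exact Finset.mem_image.mpr ⟨(name, code), Finset.mem_univ _, funext hcode⟩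
    _ ≤ _ := Finset.card_image_le.trans (by simp)

/-! ### Moments of the entries of a word in Haar unitaries -/

theorem matrix_prod_ofFn_apply {R m : Type*} [CommSemiring R] [Fintype m] [DecidableEq m] {L : ℕ}
    (A : Fin L → Matrix m m R) (a b : m) :
    (List.ofFn A).prod a b =
      ∑ f : Fin (L + 1) → m with f 0 = a ∧ f (Fin.last L) = b,
        ∏ k, A k (f k.castSucc) (f k.succ) := by
  rw [Finset.sum_filter]
  induction L generalizing a with
  | zero =>
    rw [← (Equiv.funUnique (Fin 1) m).symm.sum_comp]
    by_cases h : a = b <;> simp [Finset.filter_and, h, Finset.filter_eq']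
  | succ L ih =>
    rw [List.ofFn_succ, List.prod_cons, Matrix.mul_apply, eq_comm,
      ← (Fin.consEquiv fun _ => m).sum_comp, Fintype.sum_prod_type, Finset.sum_eq_single a]
    · simp only [ih, Finset.mul_sum, Fin.consEquiv_apply, Fin.cons_zero, true_and]
      rw [Finset.sum_comm]
      refine Finset.sum_congr rfl fun f _ => ?_
      rw [eq_comm, Finset.sum_eq_single (f 0), ← Fin.succ_last, Fin.cons_succ]
      · simp [Fin.prod_univ_succ]
      · exact fun c _ hc => by simp [hc.symm]
      · simp
    · exact fun x _ hx => by simp [hx]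
    · simp

instance unitaryHaar.isMulRightInvariant (n : ℕ) : (unitaryHaar n).IsMulRightInvariant := by
  refine ⟨fun g => ?_⟩
  have : IsProbabilityMeasure ((unitaryHaar n).map (· * g)) :=
    Measure.isProbabilityMeasure_map (by fun_prop)
  exact Measure.isHaarMeasure_eq_of_isProbabilityMeasure _ _

section Word

variable {ι : Type*} {n : ℕ}

/-- The value in a group of a letter `(x, b)`, which stands for the generator `x` if `b` is `true`
and for its inverse otherwise, as in `FreeGroup.mk`. -/
def letterVal {G : Type*} [Group G] (g : ι → G) (a : ι × Bool) : G :=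
  bif a.2 then g a.1 else (g a.1)⁻¹

theorem continuous_letterVal {G : Type*} [Group G] [TopologicalSpace G] [ContinuousInv G]
    (a : ι × Bool) : Continuous fun g : ι → G => letterVal g a := by
  unfold letterVal
  cases a.2
  · exact (continuous_apply a.1).inv
  · exact continuous_apply a.1

theorem continuous_letterVal_apply (a : ι × Bool) (i j : Fin n) :
    Continuous fun g : ι → UnitaryGrp n => letterVal g a i j :=
  (UnitaryGrp.continuous_apply i j).comp (continuous_letterVal a)

/-- The joint law of independent Haar unitaries indexed by `ι`. -/
noncomputable abbrev haarPi (ι : Type*) [Fintype ι] (n : ℕ) : Measure (ι → UnitaryGrp n) :=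
  Measure.pi fun _ => unitaryHaar n

theorem integral_norm_letterVal_pow_le [Fintype ι] (D : ℕ) (a : ι × Bool) (i j : Fin n) :
    ∫ g, ‖letterVal g a i j‖ ^ (2 * D) ∂haarPi ι n ≤ D.factorial / (n : ℝ) ^ D := by
  have hgen (i j : Fin n) :
      ∫ g, ‖g a.1 i j‖ ^ (2 * D) ∂haarPi ι n ≤ D.factorial / (n : ℝ) ^ D := by
    have heval := measurePreserving_eval (fun _ : ι => unitaryHaar n) a.1
    refine le_of_eq_of_le ?_ (UnitaryGrp.integral_norm_entry_pow_le D i j)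
    rw [← heval.map_eq, integral_map heval.aemeasurable]
    exact ((UnitaryGrp.continuous_apply i j).norm.pow _).aestronglyMeasurable
  obtain ⟨x, b⟩ := a
  cases b
  · simp only [letterVal, cond_false, UnitaryGrp.inv_apply, norm_star]
    exact hgen j i
  · exact hgen i j

/-- The sign matrix with the entry `-1` at the place `v`. -/
noncomputable def signAt (v : Fin n) : UnitaryGrp n :=
  UnitaryGrp.diagonal (Pi.mulSingle v (-1))

theorem coe_mulSingle_neg_one (v i : Fin n) :
    (((Pi.mulSingle v (-1) : Fin n → Circle) i : Circle) : ℂ) = if i = v then -1 else 1 := by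
  rw [Pi.mulSingle_apply]
  split_ifs <;> simp

theorem signAt_mul_apply (v : Fin n) (u : UnitaryGrp n) (i j : Fin n) :
    (signAt v * u) i j = (if i = v then -1 else 1) * u i j := by
  rw [signAt, UnitaryGrp.diagonal_mul_apply, coe_mulSingle_neg_one]

theorem mul_signAt_apply (v : Fin n) (u : UnitaryGrp n) (i j : Fin n) :
    (u * signAt v) i j = (if j = v then -1 else 1) * u i j := by
  rw [signAt, UnitaryGrp.mul_diagonal_apply, coe_mulSingle_neg_one, mul_comm]

theorem inv_signAt (v : Fin n) : (signAt v)⁻¹ = signAt v := by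
  rw [signAt, ← map_inv, ← Pi.mulSingle_inv]
  congr 2
  exact Subtype.ext (by simp)

/-- The substitution in the generator of the letter `a` which multiplies the value of `a` by
`signAt v` on the right. -/
noncomputable def signTwist [DecidableEq ι] (a : ι × Bool) (v : Fin n) (g : ι → UnitaryGrp n) :
    ι → UnitaryGrp n :=
  bif a.2 then g * Pi.mulSingle a.1 (signAt v) else Pi.mulSingle a.1 (signAt v) * g

theorem integral_signTwist [Fintype ι] [DecidableEq ι] {E : Type*} [NormedAddCommGroup E]
    [NormedSpace ℝ E] (a : ι × Bool) (v : Fin n) (f : (ι → UnitaryGrp n) → E) :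
    ∫ g, f (signTwist a v g) ∂haarPi ι n = ∫ g, f g ∂haarPi ι n := by
  unfold signTwist
  cases a.2
  · exact integral_mul_left_eq_self ..
  · exact integral_mul_right_eq_self ..

theorem letterVal_signTwist_self [DecidableEq ι] (a : ι × Bool) (v : Fin n)
    (g : ι → UnitaryGrp n) : letterVal (signTwist a v g) a = letterVal g a * signAt v := by
  obtain ⟨x, _ | _⟩ := a <;> simp [signTwist, letterVal, inv_signAt]

theorem letterVal_signTwist_inv [DecidableEq ι] (a : ι × Bool) (v : Fin n)
    (g : ι → UnitaryGrp n) :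
    letterVal (signTwist a v g) (a.1, !a.2) = signAt v * letterVal g (a.1, !a.2) := by
  obtain ⟨x, _ | _⟩ := a <;> simp [signTwist, letterVal, inv_signAt]

theorem letterVal_signTwist_of_ne [DecidableEq ι] {a b : ι × Bool} (h : b.1 ≠ a.1) (v : Fin n)
    (g : ι → UnitaryGrp n) : letterVal (signTwist a v g) b = letterVal g b := by
  unfold signTwist
  cases a.2 <;> simp [letterVal, h]

/-- Complex conjugation on the copies of the second summand: the value of `z` on the `2K` copies
multiplies to `‖z‖ ^ (2K)`. -/
noncomputable def copyConj {K : ℕ} : Fin K ⊕ Fin K → ℂ →+* ℂ :=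
  Sum.elim (fun _ => RingHom.id ℂ) fun _ => starRingEnd ℂ

theorem norm_copyConj {K : ℕ} (c : Fin K ⊕ Fin K) (z : ℂ) : ‖copyConj c z‖ = ‖z‖ := by
  cases c <;> simp [copyConj]

theorem continuous_copyConj {K : ℕ} (c : Fin K ⊕ Fin K) : Continuous (copyConj c) := by
  cases c
  · exact continuous_id
  · exact Complex.continuous_conj

theorem prod_copyConj (K : ℕ) (z : ℂ) :
    ∏ c : Fin K ⊕ Fin K, copyConj c z = ((‖z‖ ^ (2 * K) : ℝ) : ℂ) := by
  simp only [Fintype.prod_sum_type, copyConj, Sum.elim_inl, Sum.elim_inr, Finset.prod_const,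
    Finset.card_univ, Fintype.card_fin, RingHom.id_apply]
  rw [← mul_pow, Complex.mul_conj', ← pow_mul, Complex.ofReal_pow]

/-- The contribution to `‖w(g)_{ab}‖ ^ (2K)`, for the word `w` with the letters `l`, of the family
of paths `k ↦ F (c, k)`, one for each copy `c`. -/
noncomputable def pathTerm {L K : ℕ} (l : Fin L → ι × Bool)
    (F : (Fin K ⊕ Fin K) × Fin (L + 1) → Fin n) (g : ι → UnitaryGrp n) : ℂ :=
  ∏ x : (Fin K ⊕ Fin K) × Fin L,
    copyConj x.1 (letterVal g (l x.2) (F (x.1, x.2.castSucc)) (F (x.1, x.2.succ)))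

theorem continuous_pathTerm {L K : ℕ} (l : Fin L → ι × Bool)
    (F : (Fin K ⊕ Fin K) × Fin (L + 1) → Fin n) : Continuous (pathTerm l F) :=
  continuous_finsetProd _ fun x _ =>
    (continuous_copyConj x.1).comp (continuous_letterVal_apply ..)

theorem norm_word_apply_pow_eq_sum_pathTerm {L : ℕ} (K : ℕ) (l : Fin L → ι × Bool) (a b : Fin n)
    (g : ι → UnitaryGrp n) :
    ((‖(List.ofFn fun k => letterVal g (l k)).prod a b‖ ^ (2 * K) : ℝ) : ℂ) =
      ∑ F : (Fin K ⊕ Fin K) × Fin (L + 1) → Fin n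
        with ∀ c, F (c, 0) = a ∧ F (c, Fin.last L) = b, pathTerm l F g := by
  have hword : (List.ofFn fun k => letterVal g (l k)).prod a b =
      ∑ f : Fin (L + 1) → Fin n with f 0 = a ∧ f (Fin.last L) = b,
        ∏ k, letterVal g (l k) (f k.castSucc) (f k.succ) := by
    rw [← matrix_prod_ofFn_apply fun k => (letterVal g (l k)).1, Submonoid.coe_list_prod,
      List.map_ofFn]
    rfl
  rw [← prod_copyConj, hword]
  simp only [map_sum, map_prod]
  rw [Finset.prod_univ_sum]
  refine Finset.sum_equiv (Equiv.curry ..).symm (fun F => by simp) fun F _ => ?_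
  rw [pathTerm, Fintype.prod_prod_type]
  rfl

theorem norm_integral_pathTerm_le [Fintype ι] {L K : ℕ} (l : Fin (L + 1) → ι × Bool)
    (F : (Fin K ⊕ Fin K) × Fin (L + 2) → Fin n) :
    ‖∫ g, pathTerm l F g ∂haarPi ι n‖ ≤
      (K * (L + 1)).factorial / (n : ℝ) ^ (K * (L + 1)) := by
  rcases isEmpty_or_nonempty ((Fin K ⊕ Fin K) × Fin (L + 1)) with hempty | hne
  · obtain rfl : K = 0 := by simpa [← not_nonempty_iff, ← Fin.pos_iff_nonempty] using hempty
    simp [pathTerm]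
  have hcard : Fintype.card ((Fin K ⊕ Fin K) × Fin (L + 1)) = 2 * (K * (L + 1)) := by
    simp only [Fintype.card_prod, Fintype.card_sum, Fintype.card_fin]
    ring
  refine (norm_integral_le_integral_norm _).trans ?_
  simp only [pathTerm, norm_prod, norm_copyConj]
  refine integral_prod_le_of_integral_pow_card_le (fun x g => norm_nonneg _)
    (fun x => integrable_of_continuous ((continuous_letterVal_apply ..).norm.pow _)) fun x => ?_
  rw [hcard]
  exact integral_norm_letterVal_pow_le ..

theorem letterVal_signTwist_apply [DecidableEq ι] {L : ℕ} {l : Fin (L + 1) → ι × Bool}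
    (hl : FreeGroup.IsReduced (List.ofFn l)) (k : Fin L) (m : Fin (L + 1)) {v i j : Fin n}
    (hi : i = v → m = k.succ) (hj : j = v → m = k.castSucc) (g : ι → UnitaryGrp n) :
    letterVal (signTwist (l k.castSucc) v g) (l m) i j =
      (if j = v then -1 else 1) * letterVal g (l m) i j := by
  by_cases hgen : (l m).1 = (l k.castSucc).1
  · by_cases hsign : (l m).2 = (l k.castSucc).2
    · rw [Prod.ext hgen hsign, letterVal_signTwist_self, mul_signAt_apply]
    · have hinv : l m = ((l k.castSucc).1, !(l k.castSucc).2) :=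
        Prod.ext hgen (Bool.eq_not.mpr hsign)
      have hiv : i ≠ v := fun h => by
        obtain rfl := hi h
        exact hsign (List.isChain_ofFn.mp hl k (by omega) hgen.symm).symm
      have hjv : j ≠ v := fun h => hsign (by rw [hj h])
      rw [hinv, letterVal_signTwist_inv, signAt_mul_apply, if_neg hiv, if_neg hjv]
  · have hjv : j ≠ v := fun h => hgen (by rw [hj h])
    rw [letterVal_signTwist_of_ne hgen, if_neg hjv, one_mul]

theorem integral_pathTerm_eq_zero [Fintype ι] {L K : ℕ} {l : Fin (L + 1) → ι × Bool}
    (hl : FreeGroup.IsReduced (List.ofFn l)) {F : (Fin K ⊕ Fin K) × Fin (L + 2) → Fin n}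
    (c : Fin K ⊕ Fin K) (k : Fin L)
    (hF : ∀ q, F q = F (c, k.succ.castSucc) → q = (c, k.succ.castSucc)) :
    ∫ g, pathTerm l F g ∂haarPi ι n = 0 := by
  classical
  set v := F (c, k.succ.castSucc)
  have hcast (x : (Fin K ⊕ Fin K) × Fin (L + 1)) (h : F (x.1, x.2.castSucc) = v) :
      x.2 = k.succ :=
    Fin.castSucc_injective _ (Prod.ext_iff.mp (hF _ h)).2
  have hsucc (x : (Fin K ⊕ Fin K) × Fin (L + 1)) :
      F (x.1, x.2.succ) = v ↔ x = (c, k.castSucc) := by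
    constructor
    · intro h
      obtain ⟨hc, hk⟩ := Prod.ext_iff.mp (hF _ h)
      exact Prod.ext hc (Fin.succ_injective _ hk)
    · rintro rfl
      rfl
  have hneg (g) : pathTerm l F (signTwist (l k.castSucc) v g) = -pathTerm l F g := by
    have hentry (x : (Fin K ⊕ Fin K) × Fin (L + 1)) :=
      letterVal_signTwist_apply hl k x.2 (hcast x)
        (fun h => (Prod.ext_iff.mp ((hsucc x).mp h)).2) g
    simp only [pathTerm, hentry, hsucc, map_mul, Finset.prod_mul_distrib, apply_ite (copyConj _),
      map_neg, map_one, Finset.prod_ite_eq', Finset.mem_univ, if_true, neg_one_mul]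
  have h := integral_signTwist (l k.castSucc) v (pathTerm l F)
  simp only [hneg, integral_neg] at h
  exact self_eq_neg.mp h.symm

theorem exists_eq_succ_castSucc_of_notMem_pair {C : Type*} {L : ℕ} {a b : Fin n}
    {F : C × Fin (L + 2) → Fin n} (hends : ∀ c, F (c, 0) = a ∧ F (c, Fin.last (L + 1)) = b)
    {p : C × Fin (L + 2)} (hp : F p ∉ ({a, b} : Finset (Fin n))) :
    ∃ (c : C) (k : Fin L), p = (c, k.succ.castSucc) := by
  obtain ⟨c, p⟩ := p
  simp only [Finset.mem_insert, Finset.mem_singleton, not_or] at hp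
  cases p using Fin.lastCases with
  | last => exact absurd (hends c).2 hp.2
  | cast p =>
    cases p using Fin.cases with
    | zero => exact absurd (hends c).1 hp.1
    | succ k => exact ⟨c, k, rfl⟩

theorem card_filter_notMem_pair_le {K L : ℕ} {a b : Fin n}
    {F : (Fin K ⊕ Fin K) × Fin (L + 2) → Fin n}
    (hends : ∀ c, F (c, 0) = a ∧ F (c, Fin.last (L + 1)) = b) :
    (Finset.univ.filter fun p => F p ∉ ({a, b} : Finset (Fin n))).card ≤ 2 * (K * L) := by
  calc _ ≤ (Finset.univ.image
          fun x : (Fin K ⊕ Fin K) × Fin L => (x.1, x.2.succ.castSucc)).card := by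
        refine Finset.card_le_card fun p hp => ?_
        obtain ⟨c, k, rfl⟩ :=
          exists_eq_succ_castSucc_of_notMem_pair hends (Finset.mem_filter.mp hp).2
        exact Finset.mem_image_of_mem _ (Finset.mem_univ (c, k))
    _ ≤ Fintype.card ((Fin K ⊕ Fin K) × Fin L) := Finset.card_image_le
    _ = 2 * (K * L) := by
        simp only [Fintype.card_prod, Fintype.card_sum, Fintype.card_fin]
        ring

theorem exists_eq_of_integral_pathTerm_ne_zero [Fintype ι] {L K : ℕ} {l : Fin (L + 1) → ι × Bool}
    (hl : FreeGroup.IsReduced (List.ofFn l)) {a b : Fin n}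
    {F : (Fin K ⊕ Fin K) × Fin (L + 2) → Fin n}
    (hends : ∀ c, F (c, 0) = a ∧ F (c, Fin.last (L + 1)) = b)
    (hF : ∫ g, pathTerm l F g ∂haarPi ι n ≠ 0) (p) (hp : F p ∉ ({a, b} : Finset (Fin n))) :
    ∃ q ≠ p, F q = F p := by
  by_contra! hlonely
  obtain ⟨c, k, rfl⟩ := exists_eq_succ_castSucc_of_notMem_pair hends hp
  exact hF (integral_pathTerm_eq_zero hl c k fun q hq => by_contra fun hne => hlonely q hne hq)

theorem card_filter_integral_pathTerm_ne_zero_le [Fintype ι] {L K : ℕ}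
    {l : Fin (L + 1) → ι × Bool} (hl : FreeGroup.IsReduced (List.ofFn l)) (a b : Fin n) :
    (Finset.univ.filter fun F : (Fin K ⊕ Fin K) × Fin (L + 2) → Fin n =>
      (∀ c, F (c, 0) = a ∧ F (c, Fin.last (L + 1)) = b) ∧
        ∫ g, pathTerm l F g ∂haarPi ι n ≠ 0).card ≤
      n ^ (K * L) * (K * L + 2) ^ (2 * K * (L + 2)) := by
  have : Nonempty (Fin n) := ⟨a⟩
  calc _ ≤ (Finset.univ.filter fun F : (Fin K ⊕ Fin K) × Fin (L + 2) → Fin n =>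
          ((Finset.univ.image F).filter (· ∉ ({a, b} : Finset (Fin n)))).card ≤ K * L).card := by
        refine Finset.card_le_card (Finset.monotone_filter_right _ fun F _ hF => ?_)
        have hshared := two_mul_card_image_filter_notMem_le
          (exists_eq_of_integral_pathTerm_ne_zero hl hF.1 hF.2)
        have hinner := card_filter_notMem_pair_le hF.1
        omega
    _ ≤ n ^ (K * L) * (K * L + ({a, b} : Finset (Fin n)).card) ^ (2 * K * (L + 2)) := by
        have hcard : Fintype.card ((Fin K ⊕ Fin K) × Fin (L + 2)) = 2 * K * (L + 2) := by
          simp only [Fintype.card_prod, Fintype.card_sum, Fintype.card_fin]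
          ring
        rw [← hcard]
        simpa only [Fintype.card_fin] using card_filter_card_image_filter_notMem_le
          (β := (Fin K ⊕ Fin K) × Fin (L + 2)) ({a, b} : Finset (Fin n)) (K * L)
    _ ≤ _ := by
        gcongr
        exact Finset.card_le_two

theorem integral_norm_word_apply_pow_le [Fintype ι] {L : ℕ} (K : ℕ) {l : Fin (L + 1) → ι × Bool}
    (hl : FreeGroup.IsReduced (List.ofFn l)) (a b : Fin n) :
    ∫ g, ‖(List.ofFn fun k => letterVal g (l k)).prod a b‖ ^ (2 * K) ∂haarPi ι n ≤
      (n : ℝ) ^ (K * L) * ((K * L + 2 : ℕ) : ℝ) ^ (2 * K * (L + 2)) *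
        ((K * (L + 1)).factorial / (n : ℝ) ^ (K * (L + 1))) := by
  set B : ℝ := (K * (L + 1)).factorial / (n : ℝ) ^ (K * (L + 1))
  have hexpand : ((∫ g, ‖(List.ofFn fun k => letterVal g (l k)).prod a b‖ ^ (2 * K)
      ∂haarPi ι n : ℝ) : ℂ) = ∑ F : (Fin K ⊕ Fin K) × Fin (L + 2) → Fin n
        with ∀ c, F (c, 0) = a ∧ F (c, Fin.last (L + 1)) = b,
          ∫ g, pathTerm l F g ∂haarPi ι n := by
    rw [← integral_complex_ofReal, ← integral_finsetSum _ fun F _ =>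
      integrable_of_continuous (continuous_pathTerm l F)]
    exact integral_congr_ae (.of_forall fun g => norm_word_apply_pow_eq_sum_pathTerm K l a b g)
  rw [← Real.norm_of_nonneg (integral_nonneg fun g => by positivity :
    0 ≤ ∫ g, ‖(List.ofFn fun k => letterVal g (l k)).prod a b‖ ^ (2 * K) ∂haarPi ι n),
    ← Complex.norm_real, hexpand, ← Finset.sum_filter_ne_zero, Finset.filter_filter]
  refine (norm_sum_le_of_le _ fun F _ => norm_integral_pathTerm_le l F).trans ?_
  rw [Finset.sum_const, nsmul_eq_mul]
  gcongr
  exact_mod_cast card_filter_integral_pathTerm_ne_zero_le hl a b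

end Word

/-! ### Polynomial functions on the unitary group -/

section PolyFun

variable {n : ℕ}

/-- A matrix entry as a continuous function on the unitary group. -/
def UnitaryGrp.entry (i j : Fin n) : C(UnitaryGrp n, ℂ) :=
  ⟨fun u => u i j, UnitaryGrp.continuous_apply i j⟩

variable (n) in
/-- The polynomial functions on the unitary group, that is, the polynomials in the matrix entries
and their conjugates. -/
noncomputable def polyFun : StarSubalgebra ℂ C(UnitaryGrp n, ℂ) :=
  StarAlgebra.adjoin ℂ (Set.range fun p : Fin n × Fin n => UnitaryGrp.entry p.1 p.2)

theorem entry_mem_polyFun (i j : Fin n) : UnitaryGrp.entry i j ∈ polyFun n :=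
  StarAlgebra.subset_adjoin ℂ _ ⟨(i, j), rfl⟩

theorem polyFun_topologicalClosure : (polyFun n).topologicalClosure = ⊤ := by
  refine ContinuousMap.starSubalgebra_topologicalClosure_eq_top_of_separatesPoints _ ?_
  intro u v huv
  contrapose! huv
  exact Matrix.UnitaryGroup.ext _ _ fun i j =>
    huv (fun w => w i j) ⟨UnitaryGrp.entry i j, entry_mem_polyFun i j, rfl⟩

theorem exists_mul_eq_sum_of_mem_polyFun {f : C(UnitaryGrp n, ℂ)} (hf : f ∈ polyFun n) :
    ∃ (ι : Type) (_ : Fintype ι) (p q : ι → C(UnitaryGrp n, ℂ)), (∀ c, p c ∈ polyFun n) ∧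
      ∀ u v, f (u * v) = ∑ c, p c u * q c v := by
  induction hf using StarAlgebra.adjoin_induction with
  | mem f hf =>
    obtain ⟨⟨i, j⟩, rfl⟩ := hf
    exact ⟨Fin n, inferInstance, fun c => UnitaryGrp.entry i c, fun c => UnitaryGrp.entry c j,
      fun c => entry_mem_polyFun i c, fun u v => Matrix.mul_apply (M := u.1) (N := v.1)⟩
  | algebraMap r =>
    exact ⟨Unit, inferInstance, fun _ => algebraMap ℂ _ r, fun _ => 1,
      fun _ => algebraMap_mem _ r, fun u v => by simp⟩
  | add f g _ _ hf hg =>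
    obtain ⟨ι, _, p, q, hp, hpq⟩ := hf
    obtain ⟨κ, _, p', q', hp', hpq'⟩ := hg
    exact ⟨ι ⊕ κ, inferInstance, Sum.elim p p', Sum.elim q q',
      Sum.forall.mpr ⟨hp, hp'⟩, fun u v => by simp [hpq, hpq']⟩
  | mul f g _ _ hf hg =>
    obtain ⟨ι, _, p, q, hp, hpq⟩ := hf
    obtain ⟨κ, _, p', q', hp', hpq'⟩ := hg
    refine ⟨ι × κ, inferInstance, fun c => p c.1 * p' c.2, fun c => q c.1 * q' c.2,
      fun c => mul_mem (hp c.1) (hp' c.2), fun u v => ?_⟩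
    simp only [ContinuousMap.mul_apply, hpq, hpq', Fintype.sum_mul_sum, Fintype.sum_prod_type,
      mul_mul_mul_comm]
  | star f _ hf =>
    obtain ⟨ι, _, p, q, hp, hpq⟩ := hf
    exact ⟨ι, inferInstance, fun c => star (p c), fun c => star (q c), fun c => star_mem (hp c),
      fun u v => by simp [hpq]⟩

theorem eq_zero_of_integral_star_mul_self_eq_zero {φ : C(UnitaryGrp n, ℂ)}
    (h : ∫ u, star (φ u) * φ u ∂unitaryHaar n = 0) : φ = 0 := by
  have hnorm : ∫ u, ‖φ u‖ ^ 2 ∂unitaryHaar n = 0 := by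
    rw [← Complex.ofReal_inj, ← integral_complex_ofReal, Complex.ofReal_zero, ← h]
    exact integral_congr_ae (.of_forall fun u => by simp [Complex.conj_mul'])
  have hae := (integral_eq_zero_iff_of_nonneg (fun u => sq_nonneg ‖φ u‖)
    (integrable_of_continuous (by fun_prop))).mp hnorm
  have heq := (Continuous.ae_eq_iff_eq (unitaryHaar n) (by fun_prop) continuous_const).mp hae
  ext u
  have hu : ‖φ u‖ ^ 2 = 0 := congrFun heq u
  simpa using hu

theorem eq_zero_of_forall_polyFun_integral_mul_eq_zero {φ : C(UnitaryGrp n, ℂ)}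
    (h : ∀ p ∈ polyFun n, ∫ u, p u * φ u ∂unitaryHaar n = 0) : φ = 0 := by
  have hclosed : IsClosed {p : C(UnitaryGrp n, ℂ) | ∫ u, p u * φ u ∂unitaryHaar n = 0} := by
    have hmul : Continuous fun p : C(UnitaryGrp n, ℂ) => p * φ := by fun_prop
    exact isClosed_eq ((continuous_integral_continuousMap (unitaryHaar n)).comp hmul)
      continuous_const
  refine eq_zero_of_integral_star_mul_self_eq_zero ?_
  have hstar : star φ ∈ (polyFun n).topologicalClosure := by
    rw [polyFun_topologicalClosure]; trivial
  exact hclosed.closure_subset_iff.mpr h hstar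

theorem exists_polyFun_integral_smul_eq {E : Type*} [NormedAddCommGroup E] [NormedSpace ℂ E]
    [FiniteDimensional ℂ E] (φ : C(UnitaryGrp n, E)) (u : UnitaryGrp n) :
    ∃ p ∈ polyFun n, ∫ h, p h • φ h ∂unitaryHaar n = φ u := by
  have hint (p : C(UnitaryGrp n, ℂ)) : Integrable (fun h => p h • φ h) (unitaryHaar n) :=
    integrable_of_continuous (by fun_prop)
  let average : polyFun n →ₗ[ℂ] E :=
    { toFun := fun p => ∫ h, p.1 h • φ h ∂unitaryHaar n
      map_add' := fun p q => by
        rw [← integral_add (hint p.1) (hint q.1)]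
        simp [add_smul]
      map_smul' := fun c p => by
        rw [RingHom.id_apply, ← integral_smul]
        simp [mul_smul] }
  suffices φ u ∈ LinearMap.range average by
    obtain ⟨p, hp⟩ := this
    exact ⟨p.1, p.2, hp⟩
  by_contra hu
  obtain ⟨ℓ, hℓu, hℓ⟩ := Submodule.exists_le_ker_of_notMem hu
  let ψ : C(UnitaryGrp n, ℂ) := ⟨fun h => ℓ.toContinuousLinearMap (φ h), by fun_prop⟩
  have hψ : ψ = 0 := eq_zero_of_forall_polyFun_integral_mul_eq_zero fun p hp => by
    have hcomm := ℓ.toContinuousLinearMap.integral_comp_comm (hint p)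
    simp only [map_smul, smul_eq_mul] at hcomm
    exact hcomm.trans (hℓ ⟨⟨p, hp⟩, rfl⟩)
  exact hℓu (DFunLike.congr_fun hψ u)

theorem mem_polyFun_of_mul_eq_sum {ι : Type*} [Fintype ι] {f : C(UnitaryGrp n, ℂ)}
    {a : ι → C(UnitaryGrp n, ℂ)} {b : ι → UnitaryGrp n → ℂ}
    (hf : ∀ u v, f (u * v) = ∑ c, a c u * b c v) : f ∈ polyFun n := by
  let φ : C(UnitaryGrp n, ι → ℂ) := ⟨fun h c => a c h⁻¹, by fun_prop⟩
  obtain ⟨p, hp, hpφ⟩ := exists_polyFun_integral_smul_eq φ 1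
  have hreproduce (u : UnitaryGrp n) : f u = ∫ h, p h * f (h⁻¹ * u) ∂unitaryHaar n := by
    have hcoord (c : ι) : a c 1 = ∫ h, p h * a c h⁻¹ ∂unitaryHaar n := by
      have := congrFun hpφ c
      rw [eval_integral fun c => integrable_of_continuous (by fun_prop)] at this
      simpa [φ] using this.symm
    rw [← one_mul u, hf 1 u, one_mul]
    simp only [hf, hcoord, ← integral_mul_const, Finset.mul_sum, ← mul_assoc]
    exact (integral_finsetSum _ fun c _ => integrable_of_continuous (by fun_prop)).symm
  obtain ⟨κ, _, q, r, hq, hqr⟩ := exists_mul_eq_sum_of_mem_polyFun hp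
  have hf_eq : f = ∑ c, (∫ h, r c h * f h⁻¹ ∂unitaryHaar n) • q c := by
    ext u
    rw [hreproduce, ← integral_mul_left_eq_self (μ := unitaryHaar n)
      (fun h => p h * f (h⁻¹ * u)) u]
    simp only [mul_inv_rev, inv_mul_cancel_right, hqr, Finset.sum_mul, ContinuousMap.coe_sum,
      ContinuousMap.coe_smul, Finset.sum_apply, Pi.smul_apply, smul_eq_mul, ← integral_mul_const]
    rw [integral_finsetSum _ fun c _ => integrable_of_continuous (by fun_prop)]
    exact Finset.sum_congr rfl fun c _ => integral_congr_ae (.of_forall fun h => by ring)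
  rw [hf_eq]
  exact sum_mem fun c _ => SMulMemClass.smul_mem _ (hq c)

theorem coeff_mem_polyFun {ι : Type*} [Fintype ι] [DecidableEq ι]
    (M : UnitaryGrp n →* Matrix ι ι ℂ) (hM : ∀ a b, Continuous fun u => M u a b) (a b : ι) :
    (⟨fun u => M u a b, hM a b⟩ : C(UnitaryGrp n, ℂ)) ∈ polyFun n :=
  mem_polyFun_of_mul_eq_sum (a := fun c => ⟨fun u => M u a c, hM a c⟩)
    (b := fun c u => M u c b) fun u v => by simp [Matrix.mul_apply]

end PolyFun

/-! ### Characters of the torus -/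

section TorusChar

variable {n : ℕ}

/-- The character of the diagonal torus with weight `ω`. -/
noncomputable def torusChar (ω : Fin n → ℤ) : (Fin n → Circle) →* ℂ where
  toFun t := ∏ i, (t i : ℂ) ^ ω i
  map_one' := by simp
  map_mul' s t := by simp [mul_zpow, Finset.prod_mul_distrib]

theorem torusChar_apply (ω : Fin n → ℤ) (t : Fin n → Circle) :
    torusChar ω t = ∏ i, (t i : ℂ) ^ ω i := rfl

theorem torusChar_zero (t : Fin n → Circle) : torusChar 0 t = 1 := by simp [torusChar_apply]

theorem torusChar_add (ω ω' : Fin n → ℤ) (t : Fin n → Circle) :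
    torusChar (ω + ω') t = torusChar ω t * torusChar ω' t := by
  simp only [torusChar_apply, ← Finset.prod_mul_distrib, Pi.add_apply]
  exact Finset.prod_congr rfl fun i _ => zpow_add₀ (Circle.coe_ne_zero _) _ _

theorem torusChar_neg (ω : Fin n → ℤ) (t : Fin n → Circle) :
    torusChar (-ω) t = (torusChar ω t)⁻¹ := by
  refine eq_inv_of_mul_eq_one_left ?_
  rw [← torusChar_add, neg_add_cancel, torusChar_zero]

theorem torusChar_apply_inv (ω : Fin n → ℤ) (t : Fin n → Circle) :
    torusChar ω t⁻¹ = torusChar (-ω) t := by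
  simp [torusChar_apply]

theorem norm_torusChar (ω : Fin n → ℤ) (t : Fin n → Circle) : ‖torusChar ω t‖ = 1 := by
  simp only [torusChar_apply, norm_prod, norm_zpow, Circle.norm_coe, one_zpow,
    Finset.prod_const_one]

theorem star_torusChar (ω : Fin n → ℤ) (t : Fin n → Circle) :
    star (torusChar ω t) = torusChar (-ω) t := by
  rw [torusChar_neg, Complex.inv_eq_conj (norm_torusChar ω t), Complex.star_def]

theorem torusChar_comp_symm (ω : Fin n → ℤ) (σ : Equiv.Perm (Fin n)) (t : Fin n → Circle) :
    torusChar ω (t ∘ σ.symm) = torusChar (ω ∘ σ) t := by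
  simp only [torusChar_apply, Function.comp_apply]
  exact (Fintype.prod_equiv σ _ _ fun i => by simp).symm

theorem torusChar_single (i : Fin n) (m : ℤ) (t : Fin n → Circle) :
    torusChar (Pi.single i m) t = (t i : ℂ) ^ m := by
  rw [torusChar_apply, Finset.prod_eq_single i (fun j _ hj => by simp [hj]) (by simp),
    Pi.single_eq_same]

theorem torusChar_injective : Function.Injective (torusChar (n := n)) := by
  intro ω ω' h
  have hexp (ω : Fin n → ℤ) (i : Fin n) : torusChar ω (Pi.mulSingle i (Circle.exp 1)) =
      (Circle.exp 1 ^ ω i : Circle) := by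
    rw [torusChar_apply, Finset.prod_eq_single i (fun j _ hj => by simp [hj]) (by simp),
      Pi.mulSingle_eq_same, Circle.coe_zpow]
  funext i
  refine exp_one_zpow_injective (Circle.coe_injective ?_)
  exact (hexp ω i).symm.trans ((DFunLike.congr_fun h _).trans (hexp ω' i))

theorem linearIndependent_torusChar :
    LinearIndependent ℂ fun ω : Fin n → ℤ => (torusChar ω : (Fin n → Circle) → ℂ) :=
  (linearIndependent_monoidHom (Fin n → Circle) ℂ).comp torusChar torusChar_injective

theorem exists_linearMap_apply_eq_ite {K V ι : Type*} [Field K] [AddCommGroup V] [Module K V]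
    [DecidableEq ι] {v : ι → V} (hv : LinearIndependent K v) (i : ι) :
    ∃ c : V →ₗ[K] K, ∀ j, c (v j) = if j = i then 1 else 0 := by
  obtain ⟨c, hc⟩ := LinearMap.exists_extend (Finsupp.lapply i ∘ₗ (hv.repr : _ →ₗ[K] _))
  refine ⟨c, fun j => ?_⟩
  have hj : v j ∈ Submodule.span K (Set.range v) := Submodule.subset_span ⟨j, rfl⟩
  have hcj := LinearMap.congr_fun hc ⟨v j, hj⟩
  rw [LinearMap.comp_apply, LinearMap.comp_apply, hv.repr_eq_single j ⟨v j, hj⟩ rfl,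
    Finsupp.lapply_apply, Finsupp.single_apply] at hcj
  exact hcj

/-- The coefficient of the character of weight `ω` in a trigonometric polynomial on the torus. It is
extended (arbitrarily) to a linear functional on all functions, so that it can be applied without
checking that a function is a trigonometric polynomial. -/
noncomputable def torusCoeff (ω : Fin n → ℤ) : ((Fin n → Circle) → ℂ) →ₗ[ℂ] ℂ :=
  (exists_linearMap_apply_eq_ite linearIndependent_torusChar ω).choose

theorem torusCoeff_torusChar (ω ω' : Fin n → ℤ) :
    torusCoeff ω (torusChar ω') = if ω' = ω then 1 else 0 :=
  (exists_linearMap_apply_eq_ite linearIndependent_torusChar ω).choose_spec ω'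

variable (n) in
/-- The trigonometric polynomials on the torus. -/
noncomputable def trigPoly : Submodule ℂ ((Fin n → Circle) → ℂ) :=
  Submodule.span ℂ (Set.range fun ω : Fin n → ℤ => (torusChar ω : (Fin n → Circle) → ℂ))

theorem torusChar_mem_trigPoly (ω : Fin n → ℤ) : ⇑(torusChar ω) ∈ trigPoly n :=
  Submodule.subset_span ⟨ω, rfl⟩

theorem mul_mem_trigPoly {f g : (Fin n → Circle) → ℂ} (hf : f ∈ trigPoly n)
    (hg : g ∈ trigPoly n) : f * g ∈ trigPoly n := by
  have hmul := Submodule.mul_mem_mul hf hg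
  rw [trigPoly, Submodule.span_mul_span] at hmul
  refine Submodule.span_mono ?_ hmul
  rintro _ ⟨_, ⟨ω, rfl⟩, _, ⟨ω', rfl⟩, rfl⟩
  exact ⟨ω + ω', funext fun t => torusChar_add ω ω' t⟩

theorem star_mem_trigPoly {f : (Fin n → Circle) → ℂ} (hf : f ∈ trigPoly n) :
    star f ∈ trigPoly n := by
  induction hf using Submodule.span_induction with
  | mem f hf =>
    obtain ⟨ω, rfl⟩ := hf
    have hstar : star ⇑(torusChar ω) = torusChar (-ω) := funext (star_torusChar ω)
    exact hstar ▸ torusChar_mem_trigPoly (-ω)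
  | zero => simp
  | add f g _ _ hf hg => exact star_add f g ▸ add_mem hf hg
  | smul c f _ hf => exact star_smul c f ▸ Submodule.smul_mem _ _ hf

theorem exists_eq_sum_of_mem_trigPoly {f : (Fin n → Circle) → ℂ} (hf : f ∈ trigPoly n) :
    ∃ S : Finset (Fin n → ℤ), (∀ ω ∉ S, torusCoeff ω f = 0) ∧
      ∀ t, f t = ∑ ω ∈ S, torusCoeff ω f * torusChar ω t := by
  obtain ⟨c, rfl⟩ := Finsupp.mem_span_range_iff_exists_finsupp.mp hf
  have hcoeff (ω : Fin n → ℤ) :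
      torusCoeff ω (c.sum fun ω' a => a • (torusChar ω' : (Fin n → Circle) → ℂ)) = c ω := by
    simp only [Finsupp.sum, map_sum, map_smul, torusCoeff_torusChar, smul_eq_mul, mul_ite, mul_one,
      mul_zero, Finset.sum_ite_eq', Finsupp.mem_support_iff, ite_not, ite_eq_right_iff]
    exact Eq.symm
  refine ⟨c.support, fun ω hω => ?_, fun t => ?_⟩
  · rw [hcoeff, Finsupp.notMem_support_iff.mp hω]
  · simp only [hcoeff]
    simp only [Finsupp.sum, Finset.sum_apply, Pi.smul_apply, smul_eq_mul]

theorem torusCoeff_comp_mul_left {f : (Fin n → Circle) → ℂ} (hf : f ∈ trigPoly n)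
    (ω : Fin n → ℤ) (s : Fin n → Circle) :
    torusCoeff ω (fun t => f (s * t)) = torusChar ω s * torusCoeff ω f := by
  refine LinearMap.eqOn_span (f := torusCoeff ω ∘ₗ LinearMap.funLeft ℂ ℂ (s * ·))
    (g := torusChar ω s • torusCoeff ω) ?_ hf
  rintro _ ⟨ω', rfl⟩
  have htranslate : LinearMap.funLeft ℂ ℂ (s * ·) (torusChar ω') =
      torusChar ω' s • (torusChar ω' : (Fin n → Circle) → ℂ) := by
    funext t
    simp [LinearMap.funLeft_apply]
  rw [LinearMap.comp_apply, htranslate, map_smul, LinearMap.smul_apply, torusCoeff_torusChar]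
  split_ifs with h <;> simp [h]

theorem comp_diagonal_mem_trigPoly {f : C(UnitaryGrp n, ℂ)} (hf : f ∈ polyFun n) :
    (fun t => f (UnitaryGrp.diagonal t)) ∈ trigPoly n := by
  induction hf using StarAlgebra.adjoin_induction with
  | mem f hf =>
    obtain ⟨⟨i, j⟩, rfl⟩ := hf
    by_cases hij : i = j
    · convert torusChar_mem_trigPoly (Pi.single i 1) using 1
      funext t
      rw [torusChar_single, zpow_one]
      exact (UnitaryGrp.diagonal_apply t i j).trans (if_pos hij)
    · convert (trigPoly n).zero_mem using 1
      funext t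
      exact (UnitaryGrp.diagonal_apply t i j).trans (if_neg hij)
  | algebraMap r =>
    convert (trigPoly n).smul_mem r (torusChar_mem_trigPoly 0) using 1
    funext t
    simp [torusChar_zero]
  | add f g _ _ hf hg => exact add_mem hf hg
  | mul f g _ _ hf hg => exact mul_mem_trigPoly hf hg
  | star f _ hf => exact star_mem_trigPoly hf

end TorusChar

/-! ### Weights of a representation of the unitary group -/

section Weights

variable {n : ℕ} {κ : Type*} [Fintype κ] [DecidableEq κ] (M : UnitaryGrp n →* Matrix κ κ ℂ)

/-- The projection on the weight space of `ω` of the representation `M`, along the other weight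
spaces. It is zero if `ω` is not a weight of `M`. -/
noncomputable def weightProj (ω : Fin n → ℤ) : Matrix κ κ ℂ :=
  Matrix.of fun a b => torusCoeff ω fun t => M (UnitaryGrp.diagonal t) a b

theorem weightProj_mul_of_weight {ι : Type*} {ω : Fin n → ℤ} {N : Matrix κ ι ℂ}
    (hN : ∀ t, M (UnitaryGrp.diagonal t) * N = torusChar ω t • N) (ω' : Fin n → ℤ) :
    weightProj M ω' * N = if ω = ω' then N else 0 := by
  ext a c
  have hcol : (∑ b, N b c • fun t => M (UnitaryGrp.diagonal t) a b) =
      N a c • (torusChar ω : (Fin n → Circle) → ℂ) := by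
    funext t
    have hNac := congrFun (congrFun (hN t) a) c
    rw [Matrix.mul_apply, Matrix.smul_apply, smul_eq_mul, mul_comm] at hNac
    rw [Pi.smul_apply, smul_eq_mul, ← hNac, Finset.sum_apply]
    exact Finset.sum_congr rfl fun b _ => mul_comm _ _
  have hentry : (weightProj M ω' * N) a c =
      torusCoeff ω' (∑ b, N b c • fun t => M (UnitaryGrp.diagonal t) a b) := by
    simp only [Matrix.mul_apply, weightProj, Matrix.of_apply, map_sum, map_smul, smul_eq_mul,
      mul_comm]
  rw [hentry, hcol, map_smul, torusCoeff_torusChar]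
  split_ifs <;> simp

variable {M} (hM : ∀ a b, Continuous fun u => M u a b)
include hM

theorem coeff_diagonal_mem_trigPoly (a b : κ) :
    (fun t => M (UnitaryGrp.diagonal t) a b) ∈ trigPoly n :=
  comp_diagonal_mem_trigPoly (coeff_mem_polyFun M hM a b)

theorem exists_diagonal_eq_sum_weightProj : ∃ S : Finset (Fin n → ℤ),
    (∀ ω ∉ S, weightProj M ω = 0) ∧
      ∀ t, M (UnitaryGrp.diagonal t) = ∑ ω ∈ S, torusChar ω t • weightProj M ω := by
  choose S hS0 hS using fun a b =>
    exists_eq_sum_of_mem_trigPoly (coeff_diagonal_mem_trigPoly hM a b)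
  let T := Finset.univ.biUnion fun a => Finset.univ.biUnion fun b => S a b
  have hST (a b : κ) : S a b ⊆ T := fun ω hω => by
    simp only [T, Finset.mem_biUnion, Finset.mem_univ, true_and]
    exact ⟨a, b, hω⟩
  refine ⟨T, fun ω hω => ?_, fun t => ?_⟩ <;> ext a b
  · exact hS0 a b ω fun h => hω (hST a b h)
  · rw [Matrix.sum_apply, hS a b t, Finset.sum_subset (hST a b) fun ω _ hω => by
      rw [hS0 a b ω hω, zero_mul]]
    exact Finset.sum_congr rfl fun ω _ => mul_comm _ _

theorem finite_setOf_weightProj_ne_zero : {ω | weightProj M ω ≠ 0}.Finite := by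
  obtain ⟨S, hS, -⟩ := exists_diagonal_eq_sum_weightProj hM
  exact S.finite_toSet.subset fun ω hω => by_contra fun h => hω (hS ω h)

/-- The set of weights of a continuous matrix representation of the unitary group. -/
noncomputable def weights : Finset (Fin n → ℤ) := (finite_setOf_weightProj_ne_zero hM).toFinset

theorem mem_weights {ω : Fin n → ℤ} : ω ∈ weights hM ↔ weightProj M ω ≠ 0 :=
  Set.Finite.mem_toFinset _

theorem diagonal_eq_sum_weightProj (t : Fin n → Circle) :
    M (UnitaryGrp.diagonal t) = ∑ ω ∈ weights hM, torusChar ω t • weightProj M ω := by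
  obtain ⟨S, hS, hsum⟩ := exists_diagonal_eq_sum_weightProj hM
  have hsub : weights hM ⊆ S := fun ω hω => by_contra fun h => (mem_weights hM).mp hω (hS ω h)
  rw [hsum t, Finset.sum_subset hsub fun ω _ hω => by
    rw [not_not.mp (mt (mem_weights hM).mpr hω), smul_zero]]

theorem sum_weightProj : ∑ ω ∈ weights hM, weightProj M ω = 1 := by
  simpa using (diagonal_eq_sum_weightProj hM 1).symm

theorem diagonal_mul_weightProj (s : Fin n → Circle) (ω : Fin n → ℤ) :
    M (UnitaryGrp.diagonal s) * weightProj M ω = torusChar ω s • weightProj M ω := by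
  ext a c
  have hrow : (fun t => M (UnitaryGrp.diagonal (s * t)) a c) =
      ∑ b, M (UnitaryGrp.diagonal s) a b • fun t => M (UnitaryGrp.diagonal t) b c := by
    funext t
    simp [Matrix.mul_apply]
  have htranslate := torusCoeff_comp_mul_left (coeff_diagonal_mem_trigPoly hM a c) ω s
  rw [hrow, map_sum] at htranslate
  simp only [map_smul] at htranslate
  exact htranslate

theorem weightProj_mul_weightProj (ω ω' : Fin n → ℤ) :
    weightProj M ω * weightProj M ω' = if ω' = ω then weightProj M ω' else 0 :=
  weightProj_mul_of_weight M (fun t => diagonal_mul_weightProj hM t ω') ω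

theorem weightProj_mul_self (ω : Fin n → ℤ) :
    weightProj M ω * weightProj M ω = weightProj M ω := by
  rw [weightProj_mul_weightProj hM, if_pos rfl]

theorem weightProj_mul_diagonal (s : Fin n → Circle) (ω : Fin n → ℤ) :
    weightProj M ω * M (UnitaryGrp.diagonal s) = torusChar ω s • weightProj M ω := by
  rw [diagonal_eq_sum_weightProj hM, Finset.mul_sum]
  simp only [Matrix.mul_smul, weightProj_mul_weightProj hM, smul_ite, smul_zero,
    Finset.sum_ite_eq', mem_weights, ne_eq, ite_not, ite_eq_right_iff]
  exact fun h => by rw [h, smul_zero]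

theorem exists_trace_weightProj_eq_natCast (ω : Fin n → ℤ) :
    ∃ m : ℕ, (weightProj M ω).trace = m ∧ (weightProj M ω ≠ 0 → 1 ≤ m) := by
  have hidem : IsIdempotentElem (Matrix.toLin' (weightProj M ω)) := by
    rw [IsIdempotentElem, Module.End.mul_eq_comp, ← Matrix.toLin'_mul, weightProj_mul_self hM]
  have htrace := LinearMap.IsProj.trace (LinearMap.IsIdempotentElem.isProj_range _ hidem)
  rw [Matrix.trace_toLin'_eq] at htrace
  refine ⟨_, htrace, fun hne => Nat.one_le_iff_ne_zero.mpr fun h0 => hne ?_⟩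
  rw [h0, Nat.cast_zero, ← Matrix.trace_toLin'_eq] at htrace
  simpa using LinearMap.IsIdempotentElem.eq_zero_of_trace_eq_zero hidem htrace

theorem card_weights_le : (weights hM).card ≤ Fintype.card κ := by
  choose m hm hm1 using exists_trace_weightProj_eq_natCast hM
  have hcard : Fintype.card κ = ∑ ω ∈ weights hM, m ω := by
    have htrace := congrArg Matrix.trace (sum_weightProj hM)
    simp only [Matrix.trace_sum, hm, Matrix.trace_one] at htrace
    exact_mod_cast htrace.symm
  rw [hcard, Finset.card_eq_sum_ones]
  exact Finset.sum_le_sum fun ω hω => hm1 ω ((mem_weights hM).mp hω)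

end Weights

/-! ### Symmetry and strings of weights -/

section Rotation

variable {n : ℕ} {i j : Fin n}

/-- The projection on the coordinate plane of `i` and `j`. -/
def planeProj (i j : Fin n) : Matrix (Fin n) (Fin n) ℂ :=
  Matrix.single i i 1 + Matrix.single j j 1

/-- The infinitesimal rotation in the coordinate plane of `i` and `j`. -/
def planeGen (i j : Fin n) : Matrix (Fin n) (Fin n) ℂ :=
  Matrix.single i j 1 - Matrix.single j i 1

theorem planeProj_mul_self (h : i ≠ j) : planeProj i j * planeProj i j = planeProj i j := by
  simp [planeProj, add_mul, mul_add, h, h.symm]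

theorem planeProj_mul_planeGen (h : i ≠ j) : planeProj i j * planeGen i j = planeGen i j := by
  rw [planeProj, planeGen, add_mul, mul_sub, mul_sub]
  simp [h, h.symm, sub_eq_add_neg]

theorem planeGen_mul_planeProj (h : i ≠ j) : planeGen i j * planeProj i j = planeGen i j := by
  rw [planeProj, planeGen, mul_add, sub_mul, sub_mul]
  simp [h, h.symm, sub_eq_add_neg, add_comm]

theorem planeGen_mul_self (h : i ≠ j) : planeGen i j * planeGen i j = -planeProj i j := by
  simp only [planeProj, planeGen, sub_mul, mul_sub, Matrix.single_mul_single_same, mul_one, ne_eq,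
    h, h.symm, not_false_eq_true, Matrix.single_mul_single_of_ne]
  abel

/-- The matrix of the rotation by the angle `s` in the coordinate plane of `i` and `j`. -/
noncomputable def rotMatrix (i j : Fin n) (s : ℝ) : Matrix (Fin n) (Fin n) ℂ :=
  1 + ((Real.cos s : ℂ) - 1) • planeProj i j + (Real.sin s : ℂ) • planeGen i j

theorem rotMatrix_zero : rotMatrix i j 0 = 1 := by simp [rotMatrix]

theorem rotMatrix_add (h : i ≠ j) (s t : ℝ) :
    rotMatrix i j (s + t) = rotMatrix i j s * rotMatrix i j t := by
  simp only [rotMatrix, add_mul, mul_add, one_mul, mul_one, smul_mul_assoc, mul_smul_comm,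
    planeProj_mul_self h, planeProj_mul_planeGen h, planeGen_mul_planeProj h, planeGen_mul_self h,
    Real.cos_add, Real.sin_add]
  push_cast
  module

theorem star_rotMatrix (s : ℝ) : star (rotMatrix i j s) = rotMatrix i j (-s) := by
  rw [Matrix.star_eq_conjTranspose]
  simp only [rotMatrix, planeProj, planeGen, Matrix.conjTranspose_add, Matrix.conjTranspose_sub,
    Matrix.conjTranspose_smul, Matrix.conjTranspose_one, Matrix.conjTranspose_single, star_one,
    star_sub, Real.cos_neg, Real.sin_neg, RCLike.star_def, Complex.conj_ofReal]
  push_cast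
  module

theorem hasDerivAt_rotMatrix_zero (k l : Fin n) :
    HasDerivAt (fun s => rotMatrix i j s k l) (planeGen i j k l) 0 := by
  have hentry (s : ℝ) : rotMatrix i j s k l = (1 : Matrix (Fin n) (Fin n) ℂ) k l +
      ((Real.cos s : ℂ) - 1) * planeProj i j k l + (Real.sin s : ℂ) * planeGen i j k l := by
    simp [rotMatrix]
  simp only [hentry]
  refine ((((Real.hasDerivAt_cos 0).ofReal_comp.sub_const 1).mul_const _).const_add _).fun_add
    ((Real.hasDerivAt_sin 0).ofReal_comp.mul_const _) |>.congr_deriv ?_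
  simp

theorem rotMatrix_pi_div_two_apply_of_ne {k l : Fin n} (hkl : k ≠ Equiv.swap i j l) :
    rotMatrix i j (Real.pi / 2) k l = 0 := by
  have hquarter : rotMatrix i j (Real.pi / 2) = 1 - planeProj i j + planeGen i j := by
    simp only [rotMatrix, Real.cos_pi_div_two, Real.sin_pi_div_two]
    push_cast
    module
  simp only [hquarter, planeProj, planeGen, Matrix.add_apply, Matrix.sub_apply,
    Matrix.single_apply, Matrix.one_apply]
  grind

namespace UnitaryGrp

/-- The rotation by the angle `s` in the coordinate plane of `i` and `j`. -/
noncomputable def rotation (h : i ≠ j) (s : ℝ) : UnitaryGrp n :=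
  ⟨rotMatrix i j s, by
    rw [Matrix.mem_unitaryGroup_iff, star_rotMatrix, ← rotMatrix_add h, add_neg_cancel,
      rotMatrix_zero]⟩

theorem rotation_add (h : i ≠ j) (s t : ℝ) : rotation h (s + t) = rotation h s * rotation h t :=
  Subtype.ext (rotMatrix_add h s t)

theorem rotation_zero (h : i ≠ j) : rotation h 0 = 1 := Subtype.ext rotMatrix_zero

theorem conj_rotation_apply (h : i ≠ j) (t : Fin n → Circle) (s : ℝ) (k l : Fin n) :
    (diagonal t * rotation h s * diagonal t⁻¹) k l =
      t k * rotMatrix i j s k l * (t l : ℂ)⁻¹ := by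
  rw [mul_diagonal_apply, diagonal_mul_apply, Pi.inv_apply, Circle.coe_inv]
  rfl

theorem diagonal_mul_rotation_pi_div_two (h : i ≠ j) (t : Fin n → Circle) :
    diagonal t * rotation h (Real.pi / 2) =
      rotation h (Real.pi / 2) * diagonal (t ∘ (Equiv.swap i j).symm) := by
  refine Matrix.UnitaryGroup.ext _ _ fun k l => ?_
  rw [diagonal_mul_apply, mul_diagonal_apply, Equiv.symm_swap, mul_comm, Function.comp_apply]
  by_cases hkl : k = Equiv.swap i j l
  · rw [hkl]
  · have hzero : rotation h (Real.pi / 2) k l = 0 := rotMatrix_pi_div_two_apply_of_ne hkl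
    rw [hzero, zero_mul, zero_mul]

/-- The permutation matrix of `σ` as a unitary matrix. -/
noncomputable def perm (σ : Equiv.Perm (Fin n)) : UnitaryGrp n :=
  ⟨σ.permMatrix ℂ, by
    rw [Matrix.mem_unitaryGroup_iff, Matrix.star_eq_conjTranspose, Matrix.conjTranspose_permMatrix,
      ← Matrix.permMatrix_mul]
    simp⟩

theorem perm_apply (σ : Equiv.Perm (Fin n)) (i j : Fin n) :
    perm σ i j = if σ i = j then 1 else 0 := by
  change σ.permMatrix ℂ i j = _
  simp [Equiv.Perm.permMatrix, PEquiv.toMatrix_apply, Equiv.toPEquiv_apply, eq_comm]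

theorem diagonal_mul_perm (t : Fin n → Circle) (σ : Equiv.Perm (Fin n)) :
    diagonal t * perm σ = perm σ * diagonal (t ∘ σ.symm) := by
  refine Matrix.UnitaryGroup.ext _ _ fun i j => ?_
  rw [diagonal_mul_apply, mul_diagonal_apply, perm_apply]
  by_cases h : σ i = j
  · subst h; simp
  · simp [h]

end UnitaryGrp

/-- The root `e_i - e_j`. -/
def root (i j : Fin n) : Fin n → ℤ := Pi.single i 1 - Pi.single j 1

theorem torusChar_root (i j : Fin n) (t : Fin n → Circle) :
    torusChar (root i j) t = t i * (t j : ℂ)⁻¹ := by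
  rw [root, sub_eq_add_neg, torusChar_add, torusChar_neg, torusChar_single, torusChar_single]
  simp

theorem mul_single_apply_mul_inv (t : Fin n → Circle) (k l : Fin n) :
    (t k : ℂ) * Matrix.single i j (1 : ℂ) k l * (t l : ℂ)⁻¹ =
      torusChar (root i j) t * Matrix.single i j (1 : ℂ) k l := by
  rw [torusChar_root, Matrix.single_apply]
  split_ifs with h
  · rw [h.1, h.2]; ring
  · simp

theorem exists_hasDerivAt_conj_rotation (h : i ≠ j) {f : C(UnitaryGrp n, ℂ)} (hf : f ∈ polyFun n) :
    ∃ x y : ℂ, ∀ t : Fin n → Circle,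
      HasDerivAt (fun s : ℝ => f (.diagonal t * .rotation h s * .diagonal t⁻¹))
        (torusChar (root i j) t * x + torusChar (-root i j) t * y) 0 := by
  induction hf using StarAlgebra.adjoin_induction with
  | mem f hf =>
    obtain ⟨⟨k, l⟩, rfl⟩ := hf
    refine ⟨Matrix.single i j 1 k l, -Matrix.single j i 1 k l, fun t => ?_⟩
    have hneg : -root i j = root j i := neg_sub _ _
    have hcurve : (fun s : ℝ => UnitaryGrp.entry k l
        (.diagonal t * .rotation h s * .diagonal t⁻¹)) =
          fun s => t k * rotMatrix i j s k l * (t l : ℂ)⁻¹ :=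
      funext fun s => UnitaryGrp.conj_rotation_apply h t s k l
    refine hcurve ▸ (((hasDerivAt_rotMatrix_zero k l).const_mul _).mul_const _).congr_deriv ?_
    rw [hneg, planeGen, Matrix.sub_apply, mul_sub, sub_mul, mul_single_apply_mul_inv,
      mul_single_apply_mul_inv, mul_neg, ← sub_eq_add_neg]
  | algebraMap r => exact ⟨0, 0, fun t => by simpa using hasDerivAt_const (0 : ℝ) r⟩
  | add f g _ _ hf hg =>
    obtain ⟨x, y, hxy⟩ := hf
    obtain ⟨x', y', hxy'⟩ := hg
    exact ⟨x + x', y + y', fun t => ((hxy t).fun_add (hxy' t)).congr_deriv (by ring)⟩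
  | mul f g _ _ hf hg =>
    obtain ⟨x, y, hxy⟩ := hf
    obtain ⟨x', y', hxy'⟩ := hg
    refine ⟨x * g 1 + f 1 * x', y * g 1 + f 1 * y', fun t => ?_⟩
    refine ((hxy t).fun_mul (hxy' t)).congr_deriv ?_
    rw [UnitaryGrp.rotation_zero, mul_one, ← map_mul, mul_inv_cancel, map_one]
    ring
  | star f _ hf =>
    obtain ⟨x, y, hxy⟩ := hf
    refine ⟨star y, star x, fun t => (hxy t).star.congr_deriv ?_⟩
    simp only [star_add, star_mul', star_torusChar, neg_neg]
    ring

end Rotation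

theorem mul_mul_one_sub_eq_zero_of_hasDerivAt {κ : Type*} [Fintype κ] [DecidableEq κ]
    {R : ℝ → Matrix κ κ ℂ} {D Q : Matrix κ κ ℂ}
    (hR : ∀ s a b, HasDerivAt (fun s => R s a b) ((D * R s) a b) s) (hR0 : R 0 = 1)
    (hQ : Q * Q = Q) (hQD : Q * D * (1 - Q) = 0) {s : ℝ} (hs : 0 ≤ s) :
    Q * R s * (1 - Q) = 0 := by
  have hQDQ : Q * D = Q * D * Q := by rwa [mul_sub, mul_one, sub_eq_zero] at hQD
  ext a b
  let y : ℝ → κ → ℂ := fun s => (Q * R s * (1 - Q)).col b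
  let T : (κ → ℂ) →L[ℂ] (κ → ℂ) := LinearMap.toContinuousLinearMap (Matrix.toLin' (Q * D))
  have hy (s : ℝ) : HasDerivAt y (T (y s)) s := by
    have hT : T (y s) = (Q * (D * R s) * (1 - Q)).col b := by
      rw [← mul_assoc Q D, hQDQ, mul_assoc (Q * D), mul_assoc (Q * D)]
      rfl
    rw [hT, hasDerivAt_pi]
    intro a
    simp only [y, Matrix.col_apply, Matrix.mul_apply (M := Q * _), Matrix.mul_apply (M := Q)]
    exact .fun_sum fun c _ => .mul_const (.fun_sum fun e _ => (hR s e c).const_mul _) _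
  have hy0 : y 0 = 0 := by
    simp only [y, hR0, mul_one, mul_sub, hQ, sub_self]
    rfl
  have huniq := ODE_solution_unique (v := fun _ => T) (K := ‖T‖₊) (f := y) (g := fun _ => 0)
    (b := s) (fun _ => T.lipschitz) (fun x _ => (hy x).continuousAt.continuousWithinAt)
    (fun x _ => (hy x).hasDerivWithinAt) continuousOn_const
    (fun x _ => by simpa using (hasDerivAt_const x (0 : κ → ℂ)).hasDerivWithinAt) hy0
  exact congrFun (huniq ⟨hs, le_refl s⟩) a

theorem eq_zero_of_torusChar_mul_eq_add {n : ℕ} {β α γ : Fin n → ℤ} (hα : β ≠ α) (hγ : β ≠ γ)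
    {a b c : ℂ} (h : ∀ t, torusChar β t * a = torusChar α t * b + torusChar γ t * c) : a = 0 := by
  have hfun : a • (torusChar β : (Fin n → Circle) → ℂ) =
      b • (torusChar α : (Fin n → Circle) → ℂ) + c • (torusChar γ : (Fin n → Circle) → ℂ) := by
    funext t
    simpa [mul_comm] using h t
  simpa [torusCoeff_torusChar, hα.symm, hγ.symm] using congrArg (torusCoeff β) hfun

section Strings

variable {n : ℕ} {κ : Type*} [Fintype κ] [DecidableEq κ] {M : UnitaryGrp n →* Matrix κ κ ℂ}
  (hM : ∀ a b, Continuous fun u => M u a b)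
include hM

theorem sum_weightProj_mul_self (X : Finset (Fin n → ℤ)) :
    (∑ ω ∈ X, weightProj M ω) * ∑ ω ∈ X, weightProj M ω = ∑ ω ∈ X, weightProj M ω := by
  rw [Finset.sum_mul_sum]
  refine Finset.sum_congr rfl fun ω hω => ?_
  simp only [weightProj_mul_weightProj hM, Finset.sum_ite_eq', if_pos hω]

theorem one_sub_sum_weightProj {X : Finset (Fin n → ℤ)} (hX : X ⊆ weights hM) :
    1 - ∑ ω ∈ X, weightProj M ω = ∑ ω ∈ weights hM \ X, weightProj M ω := by
  rw [← sum_weightProj hM, ← Finset.sum_sdiff hX, add_sub_cancel_right]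

theorem weightProj_mul_mul_weightProj {g : UnitaryGrp n} {σ : Equiv.Perm (Fin n)}
    (hg : ∀ t, .diagonal t * g = g * .diagonal (t ∘ σ.symm)) (ω ω' : Fin n → ℤ) :
    weightProj M ω' * (M g * weightProj M ω) =
      if ω ∘ σ = ω' then M g * weightProj M ω else 0 := by
  refine weightProj_mul_of_weight M (fun t => ?_) ω'
  rw [← mul_assoc, ← map_mul, hg, map_mul, mul_assoc, diagonal_mul_weightProj hM,
    torusChar_comp_symm, mul_smul_comm]

theorem comp_perm_mem_weights {ω : Fin n → ℤ} (hω : ω ∈ weights hM) (σ : Equiv.Perm (Fin n)) :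
    ω ∘ σ ∈ weights hM := by
  rw [mem_weights] at hω ⊢
  contrapose! hω
  have h := weightProj_mul_mul_weightProj hM (UnitaryGrp.diagonal_mul_perm · σ) ω (ω ∘ σ)
  rw [hω, zero_mul, if_pos rfl] at h
  exact ((Group.isUnit (UnitaryGrp.perm σ)).map M).mul_right_eq_zero.mp h.symm

omit hM in
theorem hasDerivAt_rep_rotation {i j : Fin n} (h : i ≠ j) {D : Matrix κ κ ℂ}
    (hD : ∀ a b, HasDerivAt (fun s => M (.rotation h s) a b) (D a b) 0) (s : ℝ) (a b : κ) :
    HasDerivAt (fun s => M (.rotation h s) a b) ((D * M (.rotation h s)) a b) s := by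
  have hshift (s' : ℝ) : M (.rotation h s') = M (.rotation h (s' - s)) * M (.rotation h s) := by
    rw [← map_mul, ← UnitaryGrp.rotation_add, sub_add_cancel]
  have hfun : (fun s' => M (.rotation h s') a b) =
      fun s' => ∑ c, M (.rotation h (s' - s)) a c * M (.rotation h s) c b := by
    funext s'
    rw [hshift s', Matrix.mul_apply]
  rw [hfun, Matrix.mul_apply]
  refine .fun_sum fun c _ => .mul_const ?_ _
  exact HasDerivAt.comp_sub_const (f := fun s => M (.rotation h s) a c) s s (by
    rw [sub_self]
    exact hD a c)

theorem exists_hasDerivAt_rep_rotation {i j : Fin n} (h : i ≠ j) :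
    ∃ D : Matrix κ κ ℂ, (∀ a b, HasDerivAt (fun s => M (.rotation h s) a b) (D a b) 0) ∧
      ∀ ω ω', ω' ≠ ω + root i j → ω' ≠ ω - root i j → weightProj M ω' * D * weightProj M ω = 0 := by
  choose x y hxy using fun a b => exists_hasDerivAt_conj_rotation h (coeff_mem_polyFun M hM a b)
  let X : Matrix κ κ ℂ := Matrix.of x
  let Y : Matrix κ κ ℂ := Matrix.of y
  have hD (a b : κ) : HasDerivAt (fun s => M (.rotation h s) a b) ((X + Y) a b) 0 := by
    simpa [X, Y] using hxy a b 1
  have hconj (t : Fin n → Circle) : M (.diagonal t) * (X + Y) * M (.diagonal t⁻¹) =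
      torusChar (root i j) t • X + torusChar (-root i j) t • Y := by
    ext a b
    refine HasDerivAt.unique ?_ (hxy a b t)
    simp only [ContinuousMap.coe_mk, map_mul, Matrix.mul_apply, Finset.sum_mul]
    exact .fun_sum fun c _ => .fun_sum fun e _ => ((hD e c).const_mul _).mul_const _
  refine ⟨X + Y, hD, fun ω ω' hadd hsub => ?_⟩
  have hsandwich (t : Fin n → Circle) :
      torusChar (ω' - ω) t • (weightProj M ω' * (X + Y) * weightProj M ω) =
        torusChar (root i j) t • (weightProj M ω' * X * weightProj M ω) +
          torusChar (-root i j) t • (weightProj M ω' * Y * weightProj M ω) := by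
    have hmul := congrArg (fun A => weightProj M ω' * A * weightProj M ω) (hconj t)
    have hω' := weightProj_mul_diagonal hM t ω'
    have hω := diagonal_mul_weightProj hM t⁻¹ ω
    simp only [← mul_assoc, hω'] at hmul
    rw [mul_assoc, hω, torusChar_apply_inv] at hmul
    simp only [smul_mul_assoc, mul_smul_comm, mul_add, add_mul] at hmul
    rw [sub_eq_add_neg, torusChar_add, mul_comm, mul_smul, mul_add, add_mul, smul_add]
    exact hmul
  ext a b
  exact eq_zero_of_torusChar_mul_eq_add (fun h => hadd (sub_eq_iff_eq_add'.mp h))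
    (fun h => hsub ((sub_eq_iff_eq_add'.mp h).trans (sub_eq_add_neg _ _).symm))
    fun t => congrFun (congrFun (hsandwich t) a) b

theorem sum_weightProj_mul_mul_one_sub_eq_zero {X : Finset (Fin n → ℤ)} (hX : X ⊆ weights hM)
    {D : Matrix κ κ ℂ}
    (hD : ∀ ω ∈ X, ∀ ω' ∈ weights hM, ω' ∉ X → weightProj M ω * D * weightProj M ω' = 0) :
    (∑ ω ∈ X, weightProj M ω) * D * (1 - ∑ ω ∈ X, weightProj M ω) = 0 := by
  rw [one_sub_sum_weightProj hM hX, Finset.sum_mul, Finset.sum_mul_sum]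
  refine Finset.sum_eq_zero fun ω hω => Finset.sum_eq_zero fun ω' hω' => ?_
  obtain ⟨hmem, hnotMem⟩ := Finset.mem_sdiff.mp hω'
  exact hD ω hω ω' hmem hnotMem

theorem sum_weightProj_mul_mul_one_sub_ne_zero {X : Finset (Fin n → ℤ)} {ω : Fin n → ℤ}
    (hω : ω ∈ weights hM) (hωX : ω ∈ X) {g : UnitaryGrp n} {σ : Equiv.Perm (Fin n)}
    (hg : ∀ t, .diagonal t * g = g * .diagonal (t ∘ σ.symm)) (hσ : ∀ ω' ∈ X, ω' ∘ σ ≠ ω) :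
    (∑ ω ∈ X, weightProj M ω) * M g * (1 - ∑ ω ∈ X, weightProj M ω) ≠ 0 := by
  intro hzero
  have hleft : weightProj M ω * ∑ ω ∈ X, weightProj M ω = weightProj M ω := by
    simp only [Finset.mul_sum, weightProj_mul_weightProj hM, Finset.sum_ite_eq', if_pos hωX]
  have hright : weightProj M ω * (M g * ∑ ω ∈ X, weightProj M ω) = 0 := by
    rw [Finset.mul_sum, Finset.mul_sum]
    refine Finset.sum_eq_zero fun ω' hω' => ?_
    rw [weightProj_mul_mul_weightProj hM hg, if_neg (hσ ω' hω')]
  have hωg : weightProj M ω * M g = 0 := by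
    have h := congrArg (weightProj M ω * ·) hzero
    simp only [← mul_assoc, hleft, mul_sub, mul_one, mul_zero] at h
    rwa [mul_assoc _ (M g), hright, sub_zero] at h
  exact (mem_weights hM).mp hω (((Group.isUnit g).map M).mul_left_eq_zero.mp hωg)

theorem sub_root_mem_weights {ω : Fin n → ℤ} (hω : ω ∈ weights hM) {i j : Fin n}
    (hij : ω j < ω i) : ω - root i j ∈ weights hM := by
  classical
  have h : i ≠ j := by rintro rfl; exact lt_irrefl _ hij
  obtain ⟨D, hD, hDzero⟩ := exists_hasDerivAt_rep_rotation hM h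
  by_contra hnot
  -- Otherwise the rotations would preserve this half-infinite string, but a quarter turn
  -- reflects it.
  let X := {ω' ∈ weights hM | ∃ k : ℕ, ω' = ω + k • root i j}
  refine sum_weightProj_mul_mul_one_sub_ne_zero hM (X := X) hω
    (Finset.mem_filter.mpr ⟨hω, 0, by simp⟩)
    (UnitaryGrp.diagonal_mul_rotation_pi_div_two h) (fun ω' hω' heq => ?_)
    (mul_mul_one_sub_eq_zero_of_hasDerivAt (R := fun s => M (.rotation h s))
      (hasDerivAt_rep_rotation h hD) (by rw [UnitaryGrp.rotation_zero, map_one])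
      (sum_weightProj_mul_self hM X)
      (sum_weightProj_mul_mul_one_sub_eq_zero hM (Finset.filter_subset _ _)
        fun ω' hω' ω'' hmem hnotX => hDzero _ _ (fun heq => ?_) (fun heq => ?_))
      (by positivity))
  · obtain ⟨-, k, rfl⟩ := Finset.mem_filter.mp hω'
    have hi := congrFun heq i
    simp only [root, nsmul_eq_mul, Function.comp_apply, Equiv.swap_apply_left, Pi.add_apply,
      Pi.mul_apply, Pi.natCast_apply, Pi.sub_apply, ne_eq, h.symm, not_false_eq_true,
      Pi.single_eq_of_ne, Pi.single_eq_same, zero_sub, mul_neg, mul_one] at hi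
    omega
  · obtain ⟨-, k, rfl⟩ := Finset.mem_filter.mp hω'
    have hprev := eq_sub_of_add_eq heq.symm
    cases k with
    | zero => exact hnot (by simpa [hprev] using hmem)
    | succ k => exact hnotX (Finset.mem_filter.mpr ⟨hmem, k, by rw [hprev, succ_nsmul]; abel⟩)
  · obtain ⟨-, k, rfl⟩ := Finset.mem_filter.mp hω'
    have hnext := eq_add_of_sub_eq heq.symm
    exact hnotX (Finset.mem_filter.mpr ⟨hmem, k + 1, by rw [hnext, succ_nsmul]; abel⟩)

end Strings

/-! ### Small sets of weights -/

section Orbits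

variable {ι α : Type*} [DecidableEq ι]

theorem card_union_image_comp_swap [DecidableEq (ι → α)] {F : Finset (ι → α)} {i j : ι} {a b : α}
    (hab : a ≠ b) (hF : ∀ f ∈ F, f i = a ∧ f j = b) :
    (F ∪ F.image (· ∘ Equiv.swap i j)).card = 2 * F.card := by
  have hdisj : Disjoint F (F.image (· ∘ Equiv.swap i j)) := by
    refine Finset.disjoint_left.mpr fun f hf hf' => ?_
    obtain ⟨g, hg, rfl⟩ := Finset.mem_image.mp hf'
    have hi := (hF _ hf).1
    rw [Function.comp_apply, Equiv.swap_apply_left, (hF g hg).2] at hi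
    exact hab hi.symm
  rw [Finset.card_union_of_disjoint hdisj,
    Finset.card_image_of_injective _ (Equiv.swap i j).surjective.injective_comp_right, two_mul]

theorem card_filter_le_card_filter_erase_erase_add_two (A : Finset ι) (i j : ι) (p : ι → Prop)
    [DecidablePred p] : {x ∈ A | p x}.card ≤ {x ∈ (A.erase i).erase j | p x}.card + 2 := by
  have hi := Finset.pred_card_le_card_erase (s := {x ∈ A | p x}) (a := i)
  have hj := Finset.pred_card_le_card_erase (s := {x ∈ A | p x}.erase i) (a := j)
  rw [Finset.filter_erase, Finset.filter_erase]
  omega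

omit [DecidableEq ι] in
theorem exists_card_filter_ne_le_and_two_pow_le [Nonempty α] [DecidableEq α] (ω : ι → α)
    (A : Finset ι) :
    ∃ (q : ℕ) (b : α) (F : Finset (ι → α)), {i ∈ A | ω i ≠ b}.card ≤ 2 * q ∧ 2 ^ q ≤ F.card ∧
      ∀ f ∈ F, ∃ σ : Equiv.Perm ι, (∀ x ∉ A, σ x = x) ∧ f = ω ∘ σ := by
  classical
  induction A using Finset.strongInduction with
  | H A ih =>
    by_cases hconst : ∃ b, ∀ i ∈ A, ω i = b
    · obtain ⟨b, hb⟩ := hconst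
      refine ⟨0, b, {ω}, by simpa using hb, by simp, fun f hf => ⟨1, fun _ _ => rfl, ?_⟩⟩
      exact Finset.mem_singleton.mp hf
    push Not at hconst
    obtain ⟨i, hi, -⟩ := hconst (Classical.arbitrary α)
    obtain ⟨j, hj, hji⟩ := hconst (ω i)
    have hsub : (A.erase i).erase j ⊂ A :=
      (Finset.erase_subset _ _).trans_ssubset (Finset.erase_ssubset hi)
    obtain ⟨q, b, F, hq, hF, hFσ⟩ := ih _ hsub
    have hFij (f) (hf : f ∈ F) : f i = ω i ∧ f j = ω j := by
      obtain ⟨σ, hσ, rfl⟩ := hFσ f hf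
      exact ⟨congrArg ω (hσ i (by simp)), congrArg ω (hσ j (by simp))⟩
    refine ⟨q + 1, b, F ∪ F.image (· ∘ Equiv.swap i j), ?_, ?_, fun f hf => ?_⟩
    · have := card_filter_le_card_filter_erase_erase_add_two A i j (ω · ≠ b)
      omega
    · rw [card_union_image_comp_swap hji.symm hFij]
      omega
    rcases Finset.mem_union.mp hf with hf | hf
    · obtain ⟨σ, hσ, rfl⟩ := hFσ f hf
      exact ⟨σ, fun x hx => hσ x fun h => hx (hsub.1 h), rfl⟩
    · obtain ⟨g, hg, rfl⟩ := Finset.mem_image.mp hf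
      obtain ⟨σ, hσ, rfl⟩ := hFσ g hg
      refine ⟨σ * Equiv.swap i j, fun x hx => ?_, rfl⟩
      rw [Equiv.Perm.mul_apply, Equiv.swap_apply_of_ne_of_ne (ne_of_mem_of_not_mem hi hx).symm
        (ne_of_mem_of_not_mem hj hx).symm]
      exact hσ x fun h => hx (hsub.1 h)

omit [DecidableEq ι]

variable [Fintype ι] [DecidableEq α] {P : Finset (ι → α)}

theorem exists_card_filter_ne_le [Nonempty α] (hperm : ∀ ω ∈ P, ∀ σ : Equiv.Perm ι, ω ∘ σ ∈ P)
    {q : ℕ} (hq : P.card < 2 ^ (q + 1)) {ω : ι → α} (hω : ω ∈ P) :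
    ∃ b, Finset.card {i | ω i ≠ b} ≤ 2 * q := by
  obtain ⟨q', b, F, hb, hF, hFσ⟩ := exists_card_filter_ne_le_and_two_pow_le ω Finset.univ
  have hFP : F ⊆ P := fun f hf => by
    obtain ⟨σ, -, rfl⟩ := hFσ f hf
    exact hperm ω hω σ
  have hlt : 2 ^ q' < 2 ^ (q + 1) := (hF.trans (Finset.card_le_card hFP)).trans_lt hq
  have := (Nat.pow_lt_pow_iff_right one_lt_two).mp hlt
  exact ⟨b, hb.trans (by omega)⟩

theorem choose_card_filter_ne_le_card (hperm : ∀ ω ∈ P, ∀ σ : Equiv.Perm ι, ω ∘ σ ∈ P) {ω : ι → α}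
    (hω : ω ∈ P) (b : α) : (Fintype.card ι).choose (Finset.card {i | ω i ≠ b}) ≤ P.card := by
  classical
  set s : Finset ι := {i | ω i ≠ b} with hs
  have hsub : Finset.powersetCard s.card Finset.univ ⊆
      P.image fun f => ({i | f i ≠ b} : Finset ι) := by
    intro t ht
    let e : {x // x ∈ t} ≃ {x // x ∈ s} :=
      Fintype.equivOfCardEq (by simp [(Finset.mem_powersetCard.mp ht).2])
    refine Finset.mem_image.mpr ⟨ω ∘ e.extendSubtype, hperm _ hω _, Finset.ext fun x => ?_⟩
    have hmem (y : ι) : y ∈ s ↔ ω y ≠ b := by simp [hs]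
    rw [Finset.mem_filter_univ, Function.comp_apply, ← hmem]
    exact ⟨fun h => by_contra fun hx => e.extendSubtype_not_mem x hx h, e.extendSubtype_mem x⟩
  have hcard := (Finset.card_le_card hsub).trans Finset.card_image_le
  rwa [Finset.card_powersetCard, Finset.card_univ] at hcard

theorem eq_of_card_filter_ne_add_card_filter_ne_lt {ω : ι → α} {b b' : α}
    (h : Finset.card {i | ω i ≠ b} + Finset.card {i | ω i ≠ b'} < Fintype.card ι) : b = b' := by
  by_contra hne
  classical
  have huniv : Finset.univ = Finset.univ.filter (ω · ≠ b) ∪ Finset.univ.filter (ω · ≠ b') := by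
    ext i
    simp only [Finset.mem_univ, Finset.mem_union, Finset.mem_filter_univ, true_iff]
    by_contra! hi
    exact hne (hi.1.symm.trans hi.2)
  have hle := Finset.card_union_le (Finset.univ.filter (ω · ≠ b)) (Finset.univ.filter (ω · ≠ b'))
  rw [← huniv, Finset.card_univ] at hle
  exact h.not_ge hle

end Orbits

section Spreading

variable {n : ℕ} {P : Finset (Fin n → ℤ)}

theorem exists_abs_sub_eq_of_mem_string
    (hstring : ∀ ω ∈ P, ∀ i j, ω j < ω i → ω - root i j ∈ P) {ω : Fin n → ℤ} (hω : ω ∈ P) {b : ℤ}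
    {i j : Fin n} (hi : 1 < |ω i - b|) (hj : ω j = b) :
    ∃ ω' ∈ P, (∀ k, k ≠ i → k ≠ j → ω' k = ω k) ∧ |ω' j - b| = 1 ∧
      |ω' i - b| = |ω i - b| - 1 := by
  have hij : i ≠ j := by rintro rfl; simp [hj] at hi
  rcases lt_or_ge b (ω i) with hlt | hge
  · refine ⟨_, hstring ω hω i j (by omega), fun k hki hkj => by simp [root, hki, hkj], ?_, ?_⟩
    · simp [root, hij.symm, hj]
    · rw [Pi.sub_apply, root, Pi.sub_apply, Pi.single_eq_same, Pi.single_eq_of_ne hij]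
      grind
  · have hne : ω i ≠ b := by rintro rfl; simp at hi
    refine ⟨_, hstring ω hω j i (by omega), fun k hki hkj => by simp [root, hki, hkj], ?_, ?_⟩
    · simp [root, hij.symm, hj]
    · rw [Pi.sub_apply, root, Pi.sub_apply, Pi.single_eq_same, Pi.single_eq_of_ne hij]
      grind

theorem exists_card_filter_ne_eq_add_one
    (hstring : ∀ ω ∈ P, ∀ i j, ω j < ω i → ω - root i j ∈ P) {ω : Fin n → ℤ} (hω : ω ∈ P) {b : ℤ}
    {i j : Fin n} (hi : 1 < |ω i - b|) (hj : ω j = b) :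
    ∃ ω' ∈ P, Finset.card {k | ω' k ≠ b} = Finset.card {k | ω k ≠ b} + 1 ∧
      ∑ k, |ω' k - b| = ∑ k, |ω k - b| := by
  have hij : i ≠ j := by rintro rfl; simp [hj] at hi
  obtain ⟨ω', hω'P, hother, hj', hi'⟩ := exists_abs_sub_eq_of_mem_string hstring hω hi hj
  refine ⟨ω', hω'P, ?_, ?_⟩
  · have hset : Finset.univ.filter (ω' · ≠ b) = insert j (Finset.univ.filter (ω · ≠ b)) := by
      ext k
      simp only [Finset.mem_filter_univ, Finset.mem_insert]
      by_cases hkj : k = j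
      · subst hkj
        simp only [true_or, iff_true]
        rintro rfl
        simp at hj'
      by_cases hki : k = i
      · subst hki
        grind
      · simp [hkj, hother k hki hkj]
    rw [hset, Finset.card_insert_of_notMem (by simp [hj])]
  · have hdiff (k : Fin n) : |ω' k - b| =
        |ω k - b| + ((if k = j then 1 else 0) - if k = i then 1 else 0) := by
      grind
    simp only [hdiff, Finset.sum_add_distrib, Finset.sum_sub_distrib, Finset.sum_ite_eq',
      Finset.mem_univ, if_true, sub_self, add_zero]

variable (hperm : ∀ ω ∈ P, ∀ σ : Equiv.Perm (Fin n), ω ∘ σ ∈ P)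
  (hstring : ∀ ω ∈ P, ∀ i j, ω j < ω i → ω - root i j ∈ P)
include hperm hstring

theorem exists_forall_abs_sub_le_one {q : ℕ} (hq : P.card < 2 ^ (q + 1)) (hn : 4 * q + 1 < n)
    {b : ℤ} {ω : Fin n → ℤ} (hω : ω ∈ P) (hb : Finset.card {i | ω i ≠ b} ≤ 2 * q) :
    ∃ ω' ∈ P, Finset.card {i | ω' i ≠ b} ≤ 2 * q ∧ ∑ i, |ω' i - b| = ∑ i, |ω i - b| ∧
      ∀ i, |ω' i - b| ≤ 1 := by
  obtain ⟨ω', hω', hmax⟩ := Finset.exists_max_image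
    {ω' ∈ P | Finset.card {i | ω' i ≠ b} ≤ 2 * q ∧ ∑ i, |ω' i - b| = ∑ i, |ω i - b|}
    (fun ω' => Finset.card {i | ω' i ≠ b}) ⟨ω, Finset.mem_filter.mpr ⟨hω, hb, rfl⟩⟩
  obtain ⟨hω'P, hb', hsum⟩ := Finset.mem_filter.mp hω'
  refine ⟨ω', hω'P, hb', hsum, ?_⟩
  by_contra! hbig
  obtain ⟨i, hi⟩ := hbig
  obtain ⟨j, hj⟩ : ∃ j, ω' j = b := by
    by_contra! hne
    rw [Finset.filter_true_of_mem fun j _ => hne j, Finset.card_univ, Fintype.card_fin] at hb'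
    omega
  obtain ⟨ω'', hω''P, hcard, hsum'⟩ := exists_card_filter_ne_eq_add_one hstring hω'P hi hj
  obtain ⟨b', hle⟩ := exists_card_filter_ne_le hperm hq hω''P
  obtain rfl : b = b' := eq_of_card_filter_ne_add_card_filter_ne_lt (ω := ω'') (by
    rw [Fintype.card_fin]
    omega)
  have := hmax ω'' (Finset.mem_filter.mpr ⟨hω''P, hle, hsum'.trans hsum⟩)
  omega

theorem exists_choose_sum_natAbs_sub_le {q : ℕ} (hq : P.card < 2 ^ (q + 1)) (hn : 4 * q + 1 < n)
    {ω : Fin n → ℤ} (hω : ω ∈ P) : ∃ b : ℤ, ∑ i, (ω i - b).natAbs ≤ 2 * q ∧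
      n.choose (∑ i, (ω i - b).natAbs) ≤ P.card := by
  obtain ⟨b, hb⟩ := exists_card_filter_ne_le hperm hq hω
  obtain ⟨ω', hω', hcard, hsum, hone⟩ := exists_forall_abs_sub_le_one hperm hstring hq hn hω hb
  have hsum_eq : ∑ i, (ω i - b).natAbs = Finset.card {i | ω' i ≠ b} := by
    zify
    rw [← hsum, Finset.card_filter]
    push_cast
    refine Finset.sum_congr rfl fun i _ => ?_
    have := hone i
    grind
  refine ⟨b, hsum_eq.trans_le hcard, ?_⟩
  simpa only [hsum_eq, Fintype.card_fin] using choose_card_filter_ne_le_card hperm hω' b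

end Spreading

/-! ### Diagonalization of unitary matrices -/

section Diagonalization

open Polynomial

variable {ι : Type*} [Fintype ι] [DecidableEq ι] {A : Matrix ι ι ℂ}

open scoped Matrix.Norms.L2Operator in
theorem exists_isHermitian_aeval_eq (hA : IsStarNormal A) :
    ∃ (H : Matrix ι ι ℂ) (p : ℂ[X]), H.IsHermitian ∧ aeval H p = A := by
  obtain ⟨e⟩ : Nonempty (ℂ ≃ ℝ) :=
    Cardinal.eq.mp (Cardinal.mk_complex.trans Cardinal.mk_real.symm)
  have hfin : (spectrum ℂ A).Finite := A.finite_spectrum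
  -- Any injection of `ℂ` into `ℝ` is continuous on the finite spectrum and is inverted there by a
  -- Lagrange interpolation polynomial.
  let f : ℂ → ℂ := fun z => e z
  have hf : ContinuousOn f (spectrum ℂ A) := hfin.continuousOn _
  let p := Lagrange.interpolate hfin.toFinset f id
  refine ⟨cfc f A, p, ?_, ?_⟩
  · rw [Matrix.IsHermitian, ← Matrix.star_eq_conjTranspose, ← cfc_star]
    simp [f]
  · rw [← cfc_map_polynomial p f A]
    conv_rhs => rw [← cfc_id ℂ A]
    refine cfc_congr fun z hz => ?_
    exact Lagrange.eval_interpolate_at_node _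
      (fun z _ w _ h => e.injective (Complex.ofReal_injective h)) (hfin.mem_toFinset.mpr hz)

theorem exists_eq_mul_diagonal_mul_star (hA : IsStarNormal A) :
    ∃ (V : Matrix.unitaryGroup ι ℂ) (d : ι → ℂ), A = V.1 * Matrix.diagonal d * star V.1 := by
  obtain ⟨H, p, hH, rfl⟩ := exists_isHermitian_aeval_eq hA
  refine ⟨hH.eigenvectorUnitary, aeval (RCLike.ofReal ∘ hH.eigenvalues) p, ?_⟩
  conv_lhs => rw [hH.spectral_theorem]
  rw [aeval_algHom_apply, Unitary.conjStarAlgAut_apply]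
  congr 2
  exact aeval_algHom_apply (Matrix.diagonalAlgHom ℂ) _ p

theorem UnitaryGrp.exists_eq_mul_diagonal_mul_inv {n : ℕ} (u : UnitaryGrp n) :
    ∃ (v : UnitaryGrp n) (t : Fin n → Circle), u = v * diagonal t * v⁻¹ := by
  obtain ⟨v, d, hd⟩ := exists_eq_mul_diagonal_mul_star (A := u.1) inferInstance
  have hconj : (v⁻¹ * u * v).1 = Matrix.diagonal d := by
    change star v.1 * u.1 * v.1 = _
    rw [hd, ← mul_assoc, ← mul_assoc, mul_assoc, Matrix.UnitaryGroup.star_mul_self, one_mul,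
      mul_one]
  have hnorm (i : Fin n) : ‖d i‖ = 1 := by
    have hcol := sum_norm_sq_col (v⁻¹ * u * v) i
    rw [hconj, Finset.sum_eq_single i (fun j _ hj => by simp [hj]) (by simp),
      Matrix.diagonal_apply_eq] at hcol
    exact (pow_eq_one_iff_of_nonneg (norm_nonneg _) two_ne_zero).mp hcol
  let t (i : Fin n) : Circle := ⟨d i, mem_sphere_zero_iff_norm.mpr (hnorm i)⟩
  have ht : v⁻¹ * u * v = diagonal t := Subtype.ext hconj
  exact ⟨v, t, by rw [← ht]; group⟩

end Diagonalization

/-! ### Class functions as polynomials of bounded degree -/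

section PolyDeg

variable {n : ℕ}

/-- An entry of a unitary matrix (for `e.1 = true`), or its conjugate. -/
noncomputable def entryOrConj (e : Bool × Fin n × Fin n) (u : UnitaryGrp n) : ℂ :=
  if e.1 then u e.2.1 e.2.2 else star (u e.2.1 e.2.2)

/-- A monomial in the entries of a unitary matrix and their conjugates. -/
noncomputable def unitaryMonomial (l : List (Bool × Fin n × Fin n)) (u : UnitaryGrp n) : ℂ :=
  (l.map fun e => entryOrConj e u).prod

variable (n) in
/-- The polynomial functions of degree at most `a` in the entries and their conjugates. Its members
are bare functions, because the degree filtration is only used for characters and their Fourier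
expansion. -/
noncomputable def polyDeg (a : ℕ) : Submodule ℂ (UnitaryGrp n → ℂ) :=
  Submodule.span ℂ {f | ∃ l : List (Bool × Fin n × Fin n), l.length ≤ a ∧ f = unitaryMonomial l}

theorem continuous_entryOrConj (e : Bool × Fin n × Fin n) : Continuous (entryOrConj e) := by
  unfold entryOrConj
  split_ifs
  · exact UnitaryGrp.continuous_apply _ _
  · exact (UnitaryGrp.continuous_apply _ _).star

theorem continuous_of_mem_polyDeg {a : ℕ} {f : UnitaryGrp n → ℂ} (hf : f ∈ polyDeg n a) :
    Continuous f := by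
  induction hf using Submodule.span_induction with
  | mem f hf =>
    obtain ⟨l, -, rfl⟩ := hf
    exact continuous_list_prod _ fun e _ => continuous_entryOrConj e
  | zero => exact continuous_const
  | add f g _ _ hf hg => exact hf.add hg
  | smul c f _ hf => exact hf.const_smul c

theorem unitaryMonomial_append (l m : List (Bool × Fin n × Fin n)) :
    unitaryMonomial (l ++ m) = unitaryMonomial l * unitaryMonomial m := by
  funext u
  simp [unitaryMonomial]

theorem polyDeg_mono : Monotone (polyDeg n) := by
  refine fun a b h => Submodule.span_mono ?_
  rintro _ ⟨l, hl, rfl⟩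
  exact ⟨l, hl.trans h, rfl⟩

theorem mul_mem_polyDeg {a b : ℕ} {f g : UnitaryGrp n → ℂ} (hf : f ∈ polyDeg n a)
    (hg : g ∈ polyDeg n b) : f * g ∈ polyDeg n (a + b) := by
  have h := Submodule.mul_mem_mul hf hg
  rw [polyDeg, polyDeg, Submodule.span_mul_span] at h
  refine Submodule.span_mono ?_ h
  rintro _ ⟨_, ⟨l, hl, rfl⟩, _, ⟨m, hm, rfl⟩, rfl⟩
  exact ⟨l ++ m, by simpa using Nat.add_le_add hl hm, (unitaryMonomial_append l m).symm⟩

theorem const_mem_polyDeg (a : ℕ) (c : ℂ) : (fun _ => c) ∈ polyDeg n a := by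
  have h : (fun _ : UnitaryGrp n => c) = c • unitaryMonomial [] := by
    funext u
    simp [unitaryMonomial]
  rw [h]
  exact Submodule.smul_mem _ _ (Submodule.subset_span ⟨[], by simp, rfl⟩)

theorem entryOrConj_mem_polyDeg (e : Bool × Fin n × Fin n) : entryOrConj e ∈ polyDeg n 1 := by
  refine Submodule.subset_span ⟨[e], by simp, ?_⟩
  funext u
  simp [unitaryMonomial]

theorem pow_apply_mem_polyDeg {A : UnitaryGrp n → UnitaryGrp n}
    (hA : ∀ i j, (fun u => A u i j) ∈ polyDeg n 1) (m : ℕ) (i j : Fin n) :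
    (fun u => (A u ^ m) i j) ∈ polyDeg n m := by
  induction m generalizing j with
  | zero => simpa using const_mem_polyDeg 0 _
  | succ m ih =>
    have h : (fun u => (A u ^ (m + 1)) i j) =
        ∑ c, (fun u => (A u ^ m) i c) * fun u => A u c j := by
      funext u
      rw [pow_succ, Finset.sum_apply]
      exact Matrix.mul_apply (M := (A u ^ m).1) (N := (A u).1)
    rw [h]
    exact Submodule.sum_mem _ fun c _ => mul_mem_polyDeg (ih c) (hA c j)

theorem zpow_apply_mem_polyDeg (m : ℤ) (i j : Fin n) :
    (fun u : UnitaryGrp n => (u ^ m) i j) ∈ polyDeg n m.natAbs := by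
  rcases m.natAbs_eq with h | h
  · rw [h]
    simpa only [zpow_natCast, Int.natAbs_natCast, id_eq] using
      pow_apply_mem_polyDeg (A := id) (fun i j => entryOrConj_mem_polyDeg (true, i, j)) _ i j
  · rw [h]
    simpa only [zpow_neg, zpow_natCast, Int.natAbs_neg, Int.natAbs_natCast, inv_pow] using
      pow_apply_mem_polyDeg (A := Inv.inv) (fun i j => entryOrConj_mem_polyDeg (false, j, i)) _ i j

end PolyDeg

section ClassFunctions

variable {n s : ℕ}

/-- The power sum `∑ᵢ λᵢ ^ m` of the eigenvalues `λᵢ` of a unitary matrix. -/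
noncomputable def powTrace (m : ℤ) (u : UnitaryGrp n) : ℂ := (u ^ m).1.trace

theorem powTrace_conj (m : ℤ) (u v : UnitaryGrp n) : powTrace m (v * u * v⁻¹) = powTrace m u := by
  rw [powTrace, conj_zpow]
  change (v.1 * (u ^ m).1 * star v.1).trace = _
  rw [Matrix.trace_mul_cycle, Matrix.UnitaryGroup.star_mul_self, one_mul]
  rfl

theorem powTrace_diagonal (m : ℤ) (t : Fin n → Circle) :
    powTrace m (UnitaryGrp.diagonal t) = ∑ i, (t i : ℂ) ^ m := by
  rw [powTrace, ← map_zpow, Matrix.trace]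
  refine Finset.sum_congr rfl fun i _ => ?_
  rw [Matrix.diag_apply]
  change UnitaryGrp.diagonal (t ^ m) i i = _
  rw [UnitaryGrp.diagonal_apply, if_pos rfl]
  simp

theorem powTrace_mem_polyDeg (m : ℤ) : powTrace m ∈ polyDeg n m.natAbs := by
  have h : powTrace (n := n) m = ∑ i, fun u : UnitaryGrp n => (u ^ m) i i := by
    funext u
    rw [Finset.sum_apply]
    rfl
  rw [h]
  exact Submodule.sum_mem _ fun i _ => zpow_apply_mem_polyDeg m i i

/-- The sum of `∏ q, λ_{f q} ^ ω q` over the injections `f : Fin s → Fin n`, where the `λᵢ` are the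
eigenvalues of a unitary matrix. The recursion lets the first eigenvalue range freely and subtracts
the terms in which it coincides with a later one; this exhibits the sum as a polynomial in the power
sums. -/
noncomputable def injSum : (s : ℕ) → (Fin s → ℤ) → UnitaryGrp n → ℂ
  | 0, _ => fun _ => 1
  | s + 1, ω => powTrace (ω 0) * injSum s (Fin.tail ω) -
      ∑ q, injSum s (Function.update (Fin.tail ω) q (Fin.tail ω q + ω 0))

theorem injSum_conj (ω : Fin s → ℤ) (u v : UnitaryGrp n) :
    injSum s ω (v * u * v⁻¹) = injSum s ω u := by
  induction s with
  | zero => rfl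
  | succ s ih => simp [injSum, ih, powTrace_conj]

theorem sum_natAbs_update_add_le {ι : Type*} [Fintype ι] [DecidableEq ι] (ω : ι → ℤ) (q : ι)
    (m : ℤ) : ∑ i, (Function.update ω q (ω q + m) i).natAbs ≤ m.natAbs + ∑ i, (ω i).natAbs := by
  calc ∑ i, (Function.update ω q (ω q + m) i).natAbs
      ≤ ∑ i, ((if i = q then m.natAbs else 0) + (ω i).natAbs) := by
        refine Finset.sum_le_sum fun i _ => ?_
        obtain rfl | h := eq_or_ne i q
        · simpa [add_comm] using Int.natAbs_add_le (ω i) m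
        · simp [h]
    _ = _ := by simp [Finset.sum_add_distrib]

theorem injSum_mem_polyDeg (ω : Fin s → ℤ) :
    injSum s ω ∈ polyDeg n (∑ i, (ω i).natAbs) := by
  induction s with
  | zero => exact const_mem_polyDeg _ _
  | succ s ih =>
    rw [injSum, Fin.sum_univ_succ]
    exact Submodule.sub_mem _ (mul_mem_polyDeg (powTrace_mem_polyDeg _) (ih _))
      (Submodule.sum_mem _ fun q _ => polyDeg_mono (sum_natAbs_update_add_le _ q _) (ih _))

theorem prod_zpow_update_add {ι : Type*} [Fintype ι] [DecidableEq ι] {G : Type*}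
    [CommGroupWithZero G] (z : ι → G) (ω : ι → ℤ) {q : ι} (hq : z q ≠ 0) (m : ℤ) :
    ∏ i, z i ^ Function.update ω q (ω q + m) i = z q ^ m * ∏ i, z i ^ ω i := by
  rw [← Finset.mul_prod_erase Finset.univ _ (Finset.mem_univ q),
    ← Finset.mul_prod_erase Finset.univ (fun i => z i ^ ω i) (Finset.mem_univ q),
    Function.update_self, add_comm, zpow_add₀ hq, mul_assoc]
  congr 2
  exact Finset.prod_congr rfl fun i hi => by
    rw [Function.update_of_ne (Finset.ne_of_mem_erase hi)]

theorem sum_ite_notMem_range {ι κ R : Type*} [Fintype ι] [Fintype κ] [AddCommGroup R]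
    {f : ι → κ} [DecidablePred (· ∉ Set.range f)] (hf : f.Injective) (a : κ → R) :
    ∑ x, (if x ∉ Set.range f then a x else 0) = ∑ x, a x - ∑ q, a (f q) := by
  classical
  have hrange : ∑ q, a (f q) = ∑ x with x ∈ Set.range f, a x := by
    rw [← Finset.sum_image (f := a) (s := Finset.univ) hf.injOn]
    congr 1
    ext x
    simp
  rw [eq_sub_iff_add_eq, ← Finset.sum_filter, hrange, add_comm]
  convert Finset.sum_filter_add_sum_filter_not Finset.univ (· ∈ Set.range f) a

open scoped Classical in
theorem injSum_diagonal (ω : Fin s → ℤ) (t : Fin n → Circle) :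
    injSum s ω (UnitaryGrp.diagonal t) =
      ∑ f : Fin s → Fin n, if f.Injective then ∏ q, (t (f q) : ℂ) ^ ω q else 0 := by
  induction s with
  | zero => simp [injSum, Function.injective_of_subsingleton]
  | succ s ih =>
    rw [← (Fin.consEquiv fun _ => Fin n).sum_comp, Fintype.sum_prod_type, Finset.sum_comm]
    simp only [injSum, Pi.sub_apply, Pi.mul_apply, Finset.sum_apply, ih, powTrace_diagonal]
    rw [Finset.mul_sum, Finset.sum_comm, ← Finset.sum_sub_distrib]
    refine Finset.sum_congr rfl fun f _ => ?_
    have hinj (x : Fin n) : (Fin.consEquiv (fun _ => Fin n) (x, f)).Injective ↔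
        x ∉ Set.range f ∧ f.Injective := Fin.cons_injective_iff
    simp only [hinj, Fin.consEquiv_apply, Fin.prod_univ_succ, Fin.cons_zero, Fin.cons_succ]
    by_cases hf : f.Injective
    · simp only [hf, if_true, and_true]
      rw [sum_ite_notMem_range hf, ← Finset.sum_mul, ← Finset.sum_mul, ← sub_mul]
      simp only [prod_zpow_update_add (fun q => (t (f q) : ℂ)) _ (Circle.coe_ne_zero _)]
      rw [← Finset.sum_mul, ← sub_mul]
      rfl
    · simp [hf]

theorem injSum_self_diagonal (ω : Fin n → ℤ) (t : Fin n → Circle) :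
    injSum n ω (UnitaryGrp.diagonal t) = ∑ σ : Equiv.Perm (Fin n), torusChar ω (t ∘ σ) := by
  classical
  rw [injSum_diagonal, ← Finset.sum_filter]
  symm
  refine Finset.sum_bij (fun σ _ => (σ : Fin n → Fin n)) (fun σ _ => ?_) (fun σ _ τ _ h => ?_)
    (fun f hf => ?_) fun σ _ => rfl
  · simp [σ.injective]
  · exact DFunLike.coe_injective h
  · have hinj : Function.Injective f := (Finset.mem_filter.mp hf).2
    exact ⟨Equiv.ofBijective f (Finite.injective_iff_bijective.mp hinj), Finset.mem_univ _, rfl⟩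

theorem classFunction_diagonal_comp_perm {χ : UnitaryGrp n → ℂ}
    (hχ : ∀ u v, χ (v * u * v⁻¹) = χ u) (t : Fin n → Circle) (σ : Equiv.Perm (Fin n)) :
    χ (UnitaryGrp.diagonal (t ∘ σ)) = χ (UnitaryGrp.diagonal t) := by
  have h := UnitaryGrp.diagonal_mul_perm (t ∘ σ) σ
  rw [Function.comp_assoc, Equiv.self_comp_symm, Function.comp_id] at h
  rw [← hχ (UnitaryGrp.diagonal t) (.perm σ), ← h, mul_inv_cancel_right]

theorem classFunction_mem_polyDeg {χ : UnitaryGrp n → ℂ} (hχ : ∀ u v, χ (v * u * v⁻¹) = χ u)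
    {P : Finset (Fin n → ℤ)} {m : (Fin n → ℤ) → ℂ}
    (hexp : ∀ t, χ (UnitaryGrp.diagonal t) = ∑ ω ∈ P, m ω * torusChar ω t) {K : ℕ}
    (hK : ∀ ω ∈ P, ∑ i, (ω i).natAbs ≤ K) : χ ∈ polyDeg n K := by
  -- Averaging the Fourier expansion over the Weyl group turns it into a combination of `injSum`s.
  have key : χ = (n.factorial : ℂ)⁻¹ • ∑ ω ∈ P, m ω • injSum n ω := by
    funext u
    obtain ⟨v, t, rfl⟩ := UnitaryGrp.exists_eq_mul_diagonal_mul_inv u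
    simp only [hχ, Pi.smul_apply, Finset.sum_apply, injSum_conj, injSum_self_diagonal, smul_eq_mul]
    rw [eq_inv_mul_iff_mul_eq₀ (by exact_mod_cast n.factorial_ne_zero)]
    calc (n.factorial : ℂ) * χ (UnitaryGrp.diagonal t)
        = ∑ σ : Equiv.Perm (Fin n), χ (UnitaryGrp.diagonal (t ∘ σ)) := by
          simp [classFunction_diagonal_comp_perm hχ, Fintype.card_perm]
      _ = ∑ ω ∈ P, m ω * ∑ σ : Equiv.Perm (Fin n), torusChar ω (t ∘ σ) := by
          simp only [hexp, Finset.mul_sum]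
          exact Finset.sum_comm
  rw [key]
  exact Submodule.smul_mem _ _ (Submodule.sum_mem _ fun ω hω => Submodule.smul_mem _ _
    (polyDeg_mono (hK ω hω) (injSum_mem_polyDeg ω)))

end ClassFunctions

/-! ### Mixed tensor powers of the standard representation -/

section TensorPower

variable {n k : ℕ}

theorem entryOrConj_mul (e : Bool) (i j : Fin n) (u v : UnitaryGrp n) :
    entryOrConj (e, i, j) (u * v) = ∑ c, entryOrConj (e, i, c) u * entryOrConj (e, c, j) v := by
  have h : (u * v) i j = ∑ c, u i c * v c j := Matrix.mul_apply (M := u.1) (N := v.1)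
  cases e
  · simp only [entryOrConj, Bool.false_eq_true, if_false, h, star_sum, star_mul']
  · simp only [entryOrConj, if_true, h]

/-- The matrix of the tensor product of `k` factors, where the factor `q` is the standard
representation if `e q = true` and its conjugate otherwise. -/
noncomputable def tensorRep (e : Fin k → Bool) :
    UnitaryGrp n →* Matrix (Fin k → Fin n) (Fin k → Fin n) ℂ where
  toFun u := Matrix.of fun X Y => ∏ q, entryOrConj (e q, X q, Y q) u
  map_one' := by
    ext X Y
    have h (q : Fin k) : entryOrConj (e q, X q, Y q) 1 = if X q = Y q then 1 else 0 := by
      simp only [entryOrConj, Matrix.UnitaryGroup.one_apply, Matrix.one_apply]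
      split_ifs <;> simp
    simp [h, Matrix.one_apply, funext_iff, Finset.prod_ite_zero]
  map_mul' u v := by
    ext X Y
    simp only [Matrix.of_apply, Matrix.mul_apply, entryOrConj_mul, Finset.prod_univ_sum,
      Fintype.piFinset_univ, Finset.prod_mul_distrib]

theorem tensorRep_apply (e : Fin k → Bool) (u : UnitaryGrp n) (X Y : Fin k → Fin n) :
    tensorRep e u X Y = ∏ q, entryOrConj (e q, X q, Y q) u := rfl

theorem conjTranspose_tensorRep (e : Fin k → Bool) (u : UnitaryGrp n) :
    (tensorRep e u).conjTranspose = tensorRep e u⁻¹ := by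
  ext X Y
  simp only [Matrix.conjTranspose_apply, tensorRep_apply, star_prod]
  refine Finset.prod_congr rfl fun q _ => ?_
  cases h : e q <;> simp [entryOrConj, UnitaryGrp.inv_apply]

theorem norm_tensorRep_apply (e : Fin k → Bool) (u : UnitaryGrp n) (X Y : Fin k → Fin n) :
    ‖tensorRep e u X Y‖ = ∏ q, ‖u (X q) (Y q)‖ := by
  rw [tensorRep_apply, norm_prod]
  refine Finset.prod_congr rfl fun q _ => ?_
  cases h : e q <;> simp [entryOrConj]

theorem continuous_tensorRep_apply (e : Fin k → Bool) (X Y : Fin k → Fin n) :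
    Continuous fun u => tensorRep e u X Y := by
  simp only [tensorRep_apply]
  exact continuous_finsetProd _ fun _ _ => continuous_entryOrConj _

theorem tensorRep_signAt (e : Fin k → Bool) (v : Fin n) :
    tensorRep e (signAt v) = Matrix.diagonal fun X => ∏ q, if X q = v then (-1 : ℂ) else 1 := by
  ext X Y
  have h (q : Fin k) : entryOrConj (e q, X q, Y q) (signAt v) =
      if X q = Y q then (if X q = v then (-1 : ℂ) else 1) else 0 := by
    simp only [entryOrConj, signAt, UnitaryGrp.diagonal_apply, coe_mulSingle_neg_one]
    split_ifs <;> simp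
  simp only [Matrix.diagonal_apply, tensorRep_apply, h]
  split_ifs with hXY
  · simp [hXY]
  · obtain ⟨q, hq⟩ := Function.ne_iff.mp hXY
    exact Finset.prod_eq_zero (Finset.mem_univ q) (if_neg hq)

theorem unitaryMonomial_eq_tensorRep (l : List (Bool × Fin n × Fin n)) (u : UnitaryGrp n) :
    unitaryMonomial l u = tensorRep (fun q => (l.get q).1) u (fun q => (l.get q).2.1)
      (fun q => (l.get q).2.2) := by
  rw [tensorRep_apply, unitaryMonomial, ← Fin.prod_univ_fun_getElem]
  rfl

end TensorPower

/-! ### Irreducible matrix representations -/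

section Irreducible

theorem exists_mulVec_ne_zero {ι κ R : Type*} [Fintype κ] [NonAssocSemiring R] {A : Matrix ι κ R}
    (hA : A ≠ 0) : ∃ v, A.mulVec v ≠ 0 := by
  classical
  by_contra! h
  exact hA (Matrix.ext_of_mulVec_single fun i => by rw [h, Matrix.zero_mulVec])

variable {G κ F : Type*} [Group G] [Fintype κ] [DecidableEq κ] [Field F]
  {M : G →* Matrix κ κ F}

/-- Irreducibility of a representation on column vectors which is given by matrices: no proper
nonzero subspace is invariant. -/
def MatrixIrreducible (M : G →* Matrix κ κ F) : Prop :=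
  ∀ W : Submodule F (κ → F), (∀ g, ∀ v ∈ W, (M g).mulVec v ∈ W) → W = ⊥ ∨ W = ⊤

theorem MatrixIrreducible.mulVec_injective (hirr : MatrixIrreducible M) {ι : Type*} [Fintype ι]
    {A : G → Matrix ι ι F} {Φ : Matrix ι κ F} (hΦ0 : Φ ≠ 0) (hΦ : ∀ g, A g * Φ = Φ * M g) :
    Function.Injective Φ.mulVec := by
  rcases hirr (LinearMap.ker Φ.mulVecLin) fun g v (hv : Φ.mulVec v = 0) => by
    rw [LinearMap.mem_ker, Matrix.mulVecLin_apply, Matrix.mulVec_mulVec, ← hΦ,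
      ← Matrix.mulVec_mulVec, hv, Matrix.mulVec_zero] with h | h
  · exact LinearMap.ker_eq_bot.mp h
  · obtain ⟨v, hv⟩ := exists_mulVec_ne_zero hΦ0
    exact absurd (LinearMap.mem_ker.mp (h ▸ Submodule.mem_top : v ∈ _)) hv

theorem MatrixIrreducible.mulVec_eq_smul_of_mem_center (hirr : MatrixIrreducible M) {z : G}
    (hz : z ∈ Subgroup.center G) {c : F} {v : κ → F} (hv0 : v ≠ 0)
    (hv : (M z).mulVec v = c • v) (w : κ → F) : (M z).mulVec w = c • w := by
  have hmem (w : κ → F) : w ∈ LinearMap.ker ((M z).mulVecLin - c • LinearMap.id) ↔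
      (M z).mulVec w = c • w := by simp [sub_eq_zero]
  rcases hirr (LinearMap.ker ((M z).mulVecLin - c • LinearMap.id)) fun g w hw => by
    rw [hmem] at hw ⊢
    rw [Matrix.mulVec_mulVec, ← map_mul, ← Subgroup.mem_center_iff.mp hz g, map_mul,
      ← Matrix.mulVec_mulVec, hw, Matrix.mulVec_smul] with h | h
  · exact absurd ((Submodule.mem_bot F).mp (h ▸ (hmem v).mpr hv)) hv0
  · exact (hmem w).mp (h ▸ Submodule.mem_top)

theorem trace_map_conj (M : G →* Matrix κ κ F) (u v : G) :
    (M (v * u * v⁻¹)).trace = (M u).trace := by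
  rw [map_mul, map_mul, Matrix.trace_mul_cycle, ← map_mul, ← map_mul, inv_mul_cancel, one_mul]

end Irreducible

section Characters

variable {n : ℕ} {κ : Type*} [Fintype κ] [DecidableEq κ] {M : UnitaryGrp n →* Matrix κ κ ℂ}
  (hM : ∀ a b, Continuous fun u => M u a b)

theorem UnitaryGrp.diagonal_const_mem_center (z : Circle) :
    (diagonal fun _ => z) ∈ Subgroup.center (UnitaryGrp n) :=
  Subgroup.mem_center_iff.mpr fun u => Matrix.UnitaryGroup.ext _ _ fun i j => by
    rw [diagonal_mul_apply, mul_diagonal_apply, mul_comm]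

theorem torusChar_const (ω : Fin n → ℤ) (z : Circle) :
    torusChar ω (fun _ => z) = ((z ^ ∑ i, ω i : Circle) : ℂ) := by
  have h : z ^ ∑ i, ω i = ∏ i, z ^ ω i :=
    map_sum (zpowersHom Circle z).toAdditiveRight ω Finset.univ
  rw [h, torusChar_apply]
  have hcoe : ((∏ i, z ^ ω i : Circle) : ℂ) = ∏ i, ((z ^ ω i : Circle) : ℂ) :=
    map_prod Circle.coeHom (fun i => z ^ ω i) Finset.univ
  simp only [hcoe, Circle.coe_zpow]

include hM in
theorem sum_eq_sum_of_mem_weights (hirr : MatrixIrreducible M) {ω ω' : Fin n → ℤ}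
    (hω : ω ∈ weights hM) (hω' : ω' ∈ weights hM) : ∑ i, ω' i = ∑ i, ω i := by
  let z : UnitaryGrp n := .diagonal fun _ => Circle.exp 1
  have heigen (η : Fin n → ℤ) (v : κ → ℂ) : (M z).mulVec ((weightProj M η).mulVec v) =
      torusChar η (fun _ => Circle.exp 1) • (weightProj M η).mulVec v := by
    rw [Matrix.mulVec_mulVec, diagonal_mul_weightProj hM, Matrix.smul_mulVec]
  obtain ⟨v, hv⟩ := exists_mulVec_ne_zero ((mem_weights hM).mp hω)
  obtain ⟨v', hv'⟩ := exists_mulVec_ne_zero ((mem_weights hM).mp hω')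
  have hscalar := hirr.mulVec_eq_smul_of_mem_center (UnitaryGrp.diagonal_const_mem_center _) hv
    (heigen ω v) ((weightProj M ω').mulVec v')
  have heq := smul_left_injective ℂ hv' ((heigen ω' v').symm.trans hscalar)
  rw [torusChar_const, torusChar_const] at heq
  exact exp_one_zpow_injective (Circle.coe_injective heq)

include hM in
theorem exists_trace_diagonal_eq_sum : ∃ m : (Fin n → ℤ) → ℕ,
    Fintype.card κ = ∑ ω ∈ weights hM, m ω ∧
      ∀ t, (M (.diagonal t)).trace = ∑ ω ∈ weights hM, (m ω : ℂ) * torusChar ω t := by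
  choose m hm _ using exists_trace_weightProj_eq_natCast hM
  have htrace (t : Fin n → Circle) :
      (M (.diagonal t)).trace = ∑ ω ∈ weights hM, (m ω : ℂ) * torusChar ω t := by
    rw [diagonal_eq_sum_weightProj hM, Matrix.trace_sum]
    exact Finset.sum_congr rfl fun ω _ => by rw [Matrix.trace_smul, hm, smul_eq_mul, mul_comm]
  refine ⟨m, ?_, htrace⟩
  have hone := htrace 1
  simp only [map_one, Matrix.trace_one, mul_one] at hone
  exact_mod_cast hone

include hM in
theorem norm_trace_le_card (u : UnitaryGrp n) : ‖(M u).trace‖ ≤ Fintype.card κ := by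
  obtain ⟨m, hcard, hm⟩ := exists_trace_diagonal_eq_sum hM
  obtain ⟨v, t, rfl⟩ := u.exists_eq_mul_diagonal_mul_inv
  rw [trace_map_conj, hm, hcard, Nat.cast_sum]
  refine (norm_sum_le _ _).trans (Finset.sum_le_sum fun ω _ => ?_)
  rw [norm_mul, norm_torusChar, mul_one, Complex.norm_natCast]

include hM in
theorem trace_map_inv (u : UnitaryGrp n) : (M u⁻¹).trace = star (M u).trace := by
  obtain ⟨m, -, hm⟩ := exists_trace_diagonal_eq_sum hM
  obtain ⟨v, t, rfl⟩ := u.exists_eq_mul_diagonal_mul_inv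
  rw [conj_inv, ← map_inv, trace_map_conj, trace_map_conj, hm, hm, star_sum]
  refine Finset.sum_congr rfl fun ω _ => ?_
  rw [star_mul', star_natCast, torusChar_apply_inv, star_torusChar]

end Characters

/-! ### Embedding in a mixed tensor power -/

section Intertwiner

-- Schur averaging: the matrix of integrals, for fixed `Y` and `a`, is an intertwiner.
theorem exists_intertwiner_of_integral_ne_zero {G ι κ : Type*} [Group G] [TopologicalSpace G]
    [IsTopologicalGroup G] [CompactSpace G] [MeasurableSpace G] [BorelSpace G] {μ : Measure G}
    [IsFiniteMeasureOnCompacts μ] [μ.IsMulLeftInvariant] [Fintype ι] [DecidableEq ι] [Fintype κ]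
    [DecidableEq κ] {A : G →* Matrix ι ι ℂ} {B : G →* Matrix κ κ ℂ}
    (hA : ∀ X Y, Continuous fun u => A u X Y) (hB : ∀ a b, Continuous fun u => B u a b)
    {X Y : ι} {a b : κ} (h : ∫ u, A u X Y * B u⁻¹ a b ∂μ ≠ 0) :
    ∃ Φ : Matrix ι κ ℂ, Φ ≠ 0 ∧ ∀ g, A g * Φ = Φ * B g := by
  let Φ : Matrix ι κ ℂ := Matrix.of fun X b => ∫ u, A u X Y * B u⁻¹ a b ∂μ
  have hcont (X : ι) (b : κ) : Continuous fun u => A u X Y * B u⁻¹ a b :=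
    (hA X Y).fun_mul ((hB a b).comp continuous_inv)
  refine ⟨Φ, fun h0 => h (congrFun (congrFun h0 X) b), fun g => Matrix.ext fun X b => ?_⟩
  calc (A g * Φ) X b = ∫ u, A (g * u) X Y * B u⁻¹ a b ∂μ := by
        simp only [map_mul, Matrix.mul_apply, Finset.sum_mul, Φ, Matrix.of_apply,
          ← integral_const_mul, mul_assoc]
        rw [integral_finsetSum _ fun Z _ => integrable_of_continuous ((hcont Z b).const_mul _)]
    _ = ∫ u, A u X Y * B (u⁻¹ * g) a b ∂μ := by
        rw [← integral_mul_left_eq_self (fun u => A u X Y * B (u⁻¹ * g) a b) g]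
        simp only [mul_inv_rev, inv_mul_cancel_right]
    _ = (Φ * B g) X b := by
        simp only [map_mul, Matrix.mul_apply, Finset.mul_sum, Φ, Matrix.of_apply,
          ← integral_mul_const]
        rw [← integral_finsetSum _ fun c _ => integrable_of_continuous ((hcont X c).mul_const _)]
        simp only [mul_assoc]

variable {n K : ℕ} {κ : Type*} [Fintype κ] [DecidableEq κ] {M : UnitaryGrp n →* Matrix κ κ ℂ}

theorem exists_tensorRep_intertwiner_of_integral_ne_zero
    (hM : ∀ a b, Continuous fun u => M u a b) {p : UnitaryGrp n → ℂ} (hp : p ∈ polyDeg n K)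
    (hint : ∫ u, p u * (M u⁻¹).trace ∂unitaryHaar n ≠ 0) :
    ∃ k ≤ K, ∃ (e : Fin k → Bool) (Φ : Matrix (Fin k → Fin n) κ ℂ), Φ ≠ 0 ∧
      ∀ g, tensorRep e g * Φ = Φ * M g := by
  contrapose! hint
  have hMinv (a b : κ) : Continuous fun u => M u⁻¹ a b := (hM a b).comp continuous_inv
  have hcont {p : UnitaryGrp n → ℂ} (hp : p ∈ polyDeg n K) :
      Continuous fun u => p u * (M u⁻¹).trace :=
    (continuous_of_mem_polyDeg hp).fun_mul (continuous_finsetSum _ fun a _ => hMinv a a)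
  induction hp using Submodule.span_induction with
  | mem p hp =>
    obtain ⟨l, hl, rfl⟩ := hp
    simp only [unitaryMonomial_eq_tensorRep, Matrix.trace, Matrix.diag_apply, Finset.mul_sum]
    rw [integral_finsetSum _ fun a _ => integrable_of_continuous
      ((continuous_tensorRep_apply _ _ _).fun_mul (hMinv a a))]
    refine Finset.sum_eq_zero fun a _ => ?_
    by_contra h
    obtain ⟨Φ, hΦ0, hΦ⟩ :=
      exists_intertwiner_of_integral_ne_zero (continuous_tensorRep_apply _) hM h
    obtain ⟨g, hg⟩ := hint _ hl _ Φ hΦ0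
    exact hg (hΦ g)
  | zero => simp
  | add f g hf hg hf0 hg0 =>
    simp only [Pi.add_apply, add_mul]
    rw [integral_add (integrable_of_continuous (hcont hf)) (integrable_of_continuous (hcont hg)),
      hf0, hg0, add_zero]
  | smul c f _ hf0 =>
    simp only [Pi.smul_apply, smul_eq_mul, mul_assoc, integral_const_mul, hf0, mul_zero]

theorem exists_tensorRep_intertwiner [Nonempty κ] (hM : ∀ a b, Continuous fun u => M u a b)
    (hχ : (fun u => (M u).trace) ∈ polyDeg n K) :
    ∃ k ≤ K, ∃ (e : Fin k → Bool) (Φ : Matrix (Fin k → Fin n) κ ℂ), Φ ≠ 0 ∧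
      ∀ g, tensorRep e g * Φ = Φ * M g := by
  refine exists_tensorRep_intertwiner_of_integral_ne_zero hM hχ fun hint => ?_
  let χ : C(UnitaryGrp n, ℂ) := ⟨fun u => (M u).trace, continuous_of_mem_polyDeg hχ⟩
  have hχ0 : χ = 0 := eq_zero_of_integral_star_mul_self_eq_zero <| by
    rw [← hint]
    refine integral_congr_ae (.of_forall fun u => ?_)
    change star (M u).trace * (M u).trace = (M u).trace * (M u⁻¹).trace
    rw [trace_map_inv hM, mul_comm]
  have hone : (M 1).trace = 0 := DFunLike.congr_fun hχ0 1
  simp at hone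

end Intertwiner

section GramProjection

open Matrix

variable {ι κ : Type*} [Fintype ι] [Fintype κ] [DecidableEq κ] {Φ : Matrix ι κ ℂ}

/-- The matrix of the orthogonal projection onto the column space of `Φ`, provided that the columns
of `Φ` are linearly independent; otherwise the inverse has a junk value. -/
noncomputable def gramProj (Φ : Matrix ι κ ℂ) : Matrix ι ι ℂ := Φ * (Φᴴ * Φ)⁻¹ * Φᴴ

theorem conjTranspose_gramProj (Φ : Matrix ι κ ℂ) : (gramProj Φ)ᴴ = gramProj Φ := by
  simp only [gramProj, conjTranspose_mul, conjTranspose_nonsing_inv, conjTranspose_conjTranspose,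
    Matrix.mul_assoc]

open scoped ComplexOrder in
theorem inv_mul_conjTranspose_mul_self (hΦ : Function.Injective Φ.mulVec) :
    (Φᴴ * Φ)⁻¹ * (Φᴴ * Φ) = 1 :=
  nonsing_inv_mul _ ((isUnit_iff_isUnit_det _).mp (PosDef.conjTranspose_mul_self Φ hΦ).isUnit)

theorem gramProj_mul (hΦ : Function.Injective Φ.mulVec) : gramProj Φ * Φ = Φ := by
  rw [gramProj, Matrix.mul_assoc, Matrix.mul_assoc, inv_mul_conjTranspose_mul_self hΦ,
    Matrix.mul_one]

theorem isStarProjection_gramProj (hΦ : Function.Injective Φ.mulVec) :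
    IsStarProjection (gramProj Φ) where
  isIdempotentElem := by
    have h : gramProj Φ * (Φ * ((Φᴴ * Φ)⁻¹ * Φᴴ)) = Φ * ((Φᴴ * Φ)⁻¹ * Φᴴ) := by
      rw [← Matrix.mul_assoc, gramProj_mul hΦ]
    rwa [← Matrix.mul_assoc Φ] at h
  isSelfAdjoint := conjTranspose_gramProj Φ

theorem gramProj_mul_of_mul_eq (hΦ : Function.Injective Φ.mulVec) {A : Matrix ι ι ℂ}
    {B : Matrix κ κ ℂ} (hA : A * Φ = Φ * B) : gramProj Φ * A * gramProj Φ = A * gramProj Φ := by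
  have h : A * gramProj Φ = Φ * (B * (Φᴴ * Φ)⁻¹ * Φᴴ) := by
    simp only [gramProj, ← Matrix.mul_assoc, hA]
  rw [Matrix.mul_assoc, h, ← Matrix.mul_assoc, gramProj_mul hΦ]

theorem commute_gramProj (hΦ : Function.Injective Φ.mulVec) {A : Matrix ι ι ℂ} {B B' : Matrix κ κ ℂ}
    (hA : A * Φ = Φ * B) (hA' : Aᴴ * Φ = Φ * B') : Commute (gramProj Φ) A := by
  have h' := congrArg conjTranspose (gramProj_mul_of_mul_eq hΦ hA')
  simp only [conjTranspose_mul, conjTranspose_gramProj, conjTranspose_conjTranspose] at h'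
  rw [Commute, SemiconjBy, ← h', ← Matrix.mul_assoc, gramProj_mul_of_mul_eq hΦ hA]

theorem trace_gramProj_mul (hΦ : Function.Injective Φ.mulVec) {A : Matrix ι ι ℂ} {B : Matrix κ κ ℂ}
    (hA : A * Φ = Φ * B) : (gramProj Φ * A).trace = B.trace := by
  rw [trace_mul_comm, gramProj, ← Matrix.mul_assoc, ← Matrix.mul_assoc, hA, trace_mul_comm,
    ← Matrix.mul_assoc, ← Matrix.mul_assoc, trace_mul_comm, ← Matrix.mul_assoc,
    inv_mul_conjTranspose_mul_self hΦ, Matrix.one_mul]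

theorem norm_apply_le_one_of_isStarProjection {R : Matrix ι ι ℂ} (hR : IsStarProjection R)
    (i j : ι) : ‖R i j‖ ≤ 1 := by
  have hdiag (i : ι) : R i i = ((∑ j, ‖R i j‖ ^ 2 : ℝ) : ℂ) := by
    conv_lhs => rw [← hR.isIdempotentElem.eq, mul_apply]
    push_cast
    refine Finset.sum_congr rfl fun j _ => ?_
    rw [← congrFun (congrFun hR.isSelfAdjoint.star_eq j) i, star_apply, RCLike.star_def,
      Complex.mul_conj']
  have hsq (j : ι) : ‖R i j‖ ^ 2 ≤ ‖R i i‖ := by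
    rw [hdiag i, Complex.norm_real]
    exact (Finset.single_le_sum (fun j _ => sq_nonneg ‖R i j‖) (Finset.mem_univ j)).trans
      (Real.le_norm_self _)
  have hii : ‖R i i‖ ≤ 1 := by nlinarith [hsq i, norm_nonneg (R i i)]
  nlinarith [hsq j, norm_nonneg (R i j)]

end GramProjection

/-! ### Bounding a character by few products of entries -/

section RepeatedValued

variable {β γ : Type*} [Fintype β] [DecidableEq β] [Fintype γ] [DecidableEq γ]

variable (β γ) in
/-- The labellings of `β` by `γ` in which every label that occurs is used at least twice. They are
the labellings that survive the sign symmetries of the unitary group. -/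
def repeatedValued : Finset (β → γ) := {f | ∀ p, ∃ q ≠ p, f q = f p}

theorem exists_forall_ne_of_notMem_repeatedValued {f : β → γ} (hf : f ∉ repeatedValued β γ) :
    ∃ p, ∀ q ≠ p, f q ≠ f p := by
  simpa [repeatedValued] using hf

theorem card_repeatedValued_le [Nonempty γ] {m : ℕ} (hβ : Fintype.card β ≤ 2 * m) :
    (repeatedValued β γ).card ≤ Fintype.card γ ^ m * m ^ Fintype.card β := by
  refine (Finset.card_le_card fun f hf => ?_).trans
    (card_filter_card_image_filter_notMem_le (β := β) (∅ : Finset γ) m)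
  have hshared := two_mul_card_image_filter_notMem_le (A := ∅) (f := f) fun p _ =>
    (Finset.mem_filter.mp hf).2 p
  have hle : (Finset.univ.filter fun p => f p ∉ (∅ : Finset γ)).card ≤ Fintype.card β :=
    Finset.card_le_univ _
  exact Finset.mem_filter.mpr ⟨Finset.mem_univ f, by omega⟩

end RepeatedValued

section EntryBound

theorem trace_mul_eq_sum_sum_labelling {σ γ R : Type*} [Fintype σ] [DecidableEq σ] [Fintype γ]
    [NonUnitalNonAssocSemiring R] (A B : Matrix (σ → γ) (σ → γ) R) :
    (A * B).trace =
      ∑ f : σ ⊕ σ → γ, A (f ∘ Sum.inl) (f ∘ Sum.inr) * B (f ∘ Sum.inr) (f ∘ Sum.inl) := by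
  simp only [Matrix.trace, Matrix.diag_apply, Matrix.mul_apply]
  rw [← Fintype.sum_prod_type' fun X Y => A X Y * B Y X]
  exact (Fintype.sum_equiv (Equiv.sumArrowEquivProdArrow σ σ γ) _ _ fun f => rfl).symm

variable {n k : ℕ} {e : Fin k → Bool} {R : Matrix (Fin k → Fin n) (Fin k → Fin n) ℂ}

-- Conjugation by the image of the diagonal matrix with entry `-1` at the label of `p` and `1`
-- elsewhere fixes `R` and changes the sign of this entry.
theorem apply_eq_zero_of_commute_tensorRep (hR : ∀ g, Commute R (tensorRep e g))
    {f : Fin k ⊕ Fin k → Fin n} {p : Fin k ⊕ Fin k} (hp : ∀ q ≠ p, f q ≠ f p) :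
    R (f ∘ Sum.inl) (f ∘ Sum.inr) = 0 := by
  let sgn (X : Fin k → Fin n) : ℂ := ∏ q, if X q = f p then -1 else 1
  have hsgn : sgn (f ∘ Sum.inl) * sgn (f ∘ Sum.inr) = -1 := by
    change (∏ q, if f (Sum.inl q) = f p then (-1 : ℂ) else 1) *
      (∏ q, if f (Sum.inr q) = f p then (-1 : ℂ) else 1) = -1
    rw [← Fintype.prod_sum_type fun q => if f q = f p then (-1 : ℂ) else 1,
      Finset.prod_eq_single p (fun q _ hq => if_neg (hp q hq)) (by simp), if_pos rfl]
  have hsq : sgn (f ∘ Sum.inl) * sgn (f ∘ Sum.inl) = 1 := by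
    rw [← Finset.prod_mul_distrib]
    exact Finset.prod_eq_one fun q _ => by split_ifs <;> norm_num
  have hcomm := congrFun (congrFun (hR (signAt (f p))).eq (f ∘ Sum.inl)) (f ∘ Sum.inr)
  rw [tensorRep_signAt, Matrix.mul_diagonal, Matrix.diagonal_mul] at hcomm
  change R _ _ * sgn (f ∘ Sum.inr) = sgn (f ∘ Sum.inl) * R _ _ at hcomm
  linear_combination (-1 / 2 : ℂ) * sgn (f ∘ Sum.inl) * hcomm +
    (1 / 2 : ℂ) * R (f ∘ Sum.inl) (f ∘ Sum.inr) * (hsgn - hsq)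

theorem norm_trace_mul_tensorRep_le (hR : ∀ g, Commute R (tensorRep e g))
    (hR1 : ∀ X Y, ‖R X Y‖ ≤ 1) (g : UnitaryGrp n) :
    ‖(R * tensorRep e g).trace‖ ≤ ∑ f ∈ repeatedValued (Fin k ⊕ Fin k) (Fin n),
      ∏ q, ‖g (f (Sum.inr q)) (f (Sum.inl q))‖ := by
  rw [trace_mul_eq_sum_sum_labelling, ← Finset.sum_subset
    (Finset.subset_univ (repeatedValued (Fin k ⊕ Fin k) (Fin n))) fun f _ hf => by
      obtain ⟨p, hp⟩ := exists_forall_ne_of_notMem_repeatedValued hf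
      rw [apply_eq_zero_of_commute_tensorRep hR hp, zero_mul]]
  refine (norm_sum_le _ _).trans (Finset.sum_le_sum fun f _ => ?_)
  rw [norm_mul, norm_tensorRep_apply]
  exact mul_le_of_le_one_left (Finset.prod_nonneg fun _ _ => norm_nonneg _) (hR1 _ _)

variable {κ : Type*} [Fintype κ] [DecidableEq κ] [Nontrivial κ]
  {M : UnitaryGrp n →* Matrix κ κ ℂ}

theorem exists_norm_trace_le_sum_repeatedValued (hM : ∀ a b, Continuous fun u => M u a b)
    (hirr : MatrixIrreducible M) {K : ℕ} (hχ : (fun u => (M u).trace) ∈ polyDeg n K) :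
    ∃ k, 0 < k ∧ k ≤ K ∧ ∀ g, ‖(M g).trace‖ ≤
      ∑ f ∈ repeatedValued (Fin k ⊕ Fin k) (Fin n), ∏ q, ‖g (f (Sum.inr q)) (f (Sum.inl q))‖ := by
  obtain ⟨k, hk, e, Φ, hΦ0, hΦ⟩ := exists_tensorRep_intertwiner hM hχ
  have hinj := hirr.mulVec_injective hΦ0 hΦ
  have hk0 : 0 < k := by
    rw [Nat.pos_iff_ne_zero]
    rintro rfl
    have hrank := LinearMap.finrank_le_finrank_of_injective (f := Φ.mulVecLin) hinj
    have hκ := Fintype.one_lt_card (α := κ)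
    simp only [Module.finrank_fintype_fun_eq_card, Fintype.card_unique] at hrank
    omega
  refine ⟨k, hk0, hk, fun g => ?_⟩
  rw [← trace_gramProj_mul hinj (hΦ g)]
  refine norm_trace_mul_tensorRep_le (fun g => commute_gramProj hinj (hΦ g) (B' := M g⁻¹) ?_)
    (norm_apply_le_one_of_isStarProjection (isStarProjection_gramProj hinj)) g
  rw [conjTranspose_tensorRep, hΦ]

end EntryBound

/-! ### Twisting by powers of the determinant -/

section DetTwist

namespace UnitaryGrp

variable {n : ℕ}

theorem norm_det (u : UnitaryGrp n) : ‖u.1.det‖ = 1 :=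
  CStarRing.norm_of_mem_unitary (Matrix.det_of_mem_unitary u.2)

theorem det_ne_zero (u : UnitaryGrp n) : u.1.det ≠ 0 :=
  norm_ne_zero_iff.mp (by rw [norm_det]; exact one_ne_zero)

theorem det_diagonal_zpow (t : Fin n → Circle) (b : ℤ) :
    (diagonal t).1.det ^ b = torusChar (fun _ => b) t := by
  have h : (diagonal t).1 = Matrix.diagonal fun i => (t i : ℂ) := rfl
  rw [h, Matrix.det_diagonal, torusChar_apply, Finset.prod_zpow]

end UnitaryGrp

variable {n : ℕ} {κ : Type*} [Fintype κ] [DecidableEq κ] {M : UnitaryGrp n →* Matrix κ κ ℂ}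

/-- The tensor product of a matrix representation of the unitary group with the `b`-th power of the
determinant. -/
noncomputable def detTwist (b : ℤ) (M : UnitaryGrp n →* Matrix κ κ ℂ) :
    UnitaryGrp n →* Matrix κ κ ℂ where
  toFun u := (u.1.det ^ b) • M u
  map_one' := by simp
  map_mul' u v := by
    have h : (u * v).1.det = u.1.det * v.1.det := Matrix.det_mul _ _
    rw [h, map_mul, mul_zpow, smul_mul_smul_comm]

theorem detTwist_apply (b : ℤ) (u : UnitaryGrp n) : detTwist b M u = (u.1.det ^ b) • M u := rfl

theorem continuous_detTwist_apply (hM : ∀ a b, Continuous fun u => M u a b) (b : ℤ) (i j : κ) :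
    Continuous fun u => detTwist b M u i j := by
  simp only [detTwist_apply, Matrix.smul_apply, smul_eq_mul]
  have hdet : Continuous fun u : UnitaryGrp n => u.1.det := continuous_subtype_val.matrix_det
  exact (hdet.zpow₀ b fun u => Or.inl u.det_ne_zero).fun_mul (hM i j)

theorem MatrixIrreducible.detTwist (hirr : MatrixIrreducible M) (b : ℤ) :
    MatrixIrreducible (detTwist b M) := fun W hW => hirr W fun g v hv => by
  have h := hW g v hv
  rw [detTwist_apply, Matrix.smul_mulVec] at h
  exact (Submodule.smul_mem_iff W (zpow_ne_zero b g.det_ne_zero)).mp h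

theorem norm_trace_detTwist (b : ℤ) (u : UnitaryGrp n) :
    ‖(detTwist b M u).trace‖ = ‖(M u).trace‖ := by
  rw [detTwist_apply, Matrix.trace_smul, smul_eq_mul, norm_mul, norm_zpow, u.norm_det,
    one_zpow, one_mul]

theorem eq_of_sum_natAbs_sub_le {q : ℕ} (hn : 4 * q < n) {ω η : Fin n → ℤ} {b c : ℤ}
    (hsum : ∑ i, ω i = ∑ i, η i) (hω : ∑ i, (ω i - b).natAbs ≤ 2 * q)
    (hη : ∑ i, (η i - c).natAbs ≤ 2 * q) : b = c := by
  have hnear {ω : Fin n → ℤ} {b : ℤ} (hω : ∑ i, (ω i - b).natAbs ≤ 2 * q) :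
      |∑ i, ω i - n * b| ≤ 2 * q := by
    calc |∑ i, ω i - n * b| = |∑ i, (ω i - b)| := by simp
      _ ≤ ∑ i, |ω i - b| := Finset.abs_sum_le_sum_abs _ _
      _ ≤ 2 * q := by
        simp only [Int.abs_eq_natAbs]
        exact_mod_cast hω
  have hb := abs_le.mp (hnear hω)
  have hc := abs_le.mp (hnear hη)
  rw [hsum] at hb
  have hn' : (4 * q : ℤ) < n := by exact_mod_cast hn
  by_contra hne
  rcases lt_or_gt_of_ne hne with h | h <;> nlinarith [hb.1, hb.2, hc.1, hc.2, hn']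

theorem trace_detTwist_mem_polyDeg (hM : ∀ a b, Continuous fun u => M u a b) (c : ℤ) {K : ℕ}
    (hK : ∀ ω ∈ weights hM, ∑ i, (ω i - c).natAbs ≤ K) :
    (fun u => (detTwist (-c) M u).trace) ∈ polyDeg n K := by
  classical
  obtain ⟨m, -, hm⟩ := exists_trace_diagonal_eq_sum hM
  refine classFunction_mem_polyDeg (fun u v => trace_map_conj _ u v)
    (P := (weights hM).image fun ω => ω + fun _ => -c) (m := fun ω => (m (ω - fun _ => -c) : ℂ))
    (fun t => ?_) fun ω hω => ?_
  · rw [Finset.sum_image fun ω _ ω' _ h => add_right_cancel h, detTwist_apply, Matrix.trace_smul,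
      hm, UnitaryGrp.det_diagonal_zpow, smul_eq_mul, Finset.mul_sum]
    refine Finset.sum_congr rfl fun ω _ => ?_
    rw [add_sub_cancel_right, torusChar_add]
    ring
  · obtain ⟨η, hη, rfl⟩ := Finset.mem_image.mp hω
    simpa [sub_eq_add_neg] using hK η hη

theorem exists_forall_weights_sum_natAbs_sub_le (hM : ∀ a b, Continuous fun u => M u a b)
    (hirr : MatrixIrreducible M) {q : ℕ} (hq : Fintype.card κ < 2 ^ (q + 1)) (hn : 4 * q + 1 < n) :
    ∃ c : ℤ, ∀ ω ∈ weights hM, ∑ i, (ω i - c).natAbs ≤ 2 * q ∧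
      n.choose (∑ i, (ω i - c).natAbs) ≤ Fintype.card κ := by
  have hcard := card_weights_le hM
  choose! b hb hchoose using fun ω (hω : ω ∈ weights hM) => exists_choose_sum_natAbs_sub_le
    (fun ω hω σ => comp_perm_mem_weights hM hω σ)
    (fun ω hω i j hij => sub_root_mem_weights hM hω hij) (hcard.trans_lt hq) hn hω
  rcases (weights hM).eq_empty_or_nonempty with hempty | ⟨η, hη⟩
  · simp [hempty]
  · refine ⟨b η, fun ω hω => ?_⟩
    have hbeq : b ω = b η := eq_of_sum_natAbs_sub_le (by omega)
      (sum_eq_sum_of_mem_weights hM hirr hη hω) (hb ω hω) (hb η hη)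
    exact hbeq ▸ ⟨hb ω hω, (hchoose ω hω).trans hcard⟩

theorem exists_detTwist_mem_polyDeg [Nonempty κ] (hM : ∀ a b, Continuous fun u => M u a b)
    (hirr : MatrixIrreducible M) {q : ℕ} (hq : Fintype.card κ < 2 ^ (q + 1)) (hn : 4 * q + 1 < n) :
    ∃ (K : ℕ) (b : ℤ), K ≤ 2 * q ∧ n.choose K ≤ Fintype.card κ ∧
      (fun u => (detTwist b M u).trace) ∈ polyDeg n K := by
  obtain ⟨c, hc⟩ := exists_forall_weights_sum_natAbs_sub_le hM hirr hq hn
  obtain ⟨m, hm, -⟩ := exists_trace_diagonal_eq_sum hM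
  have hne : (weights hM).Nonempty := Finset.nonempty_of_sum_ne_zero (hm ▸ Fintype.card_ne_zero)
  obtain ⟨ω, hω, hmax⟩ :=
    (weights hM).exists_max_image (fun ω => ∑ i, (ω i - c).natAbs) hne
  exact ⟨_, -c, (hc ω hω).1, (hc ω hω).2, trace_detTwist_mem_polyDeg hM c hmax⟩

end DetTwist

/-! ### Characters of random unitary matrices -/

section WordTrace

theorem integral_le_sqrt_integral_sq {Ω : Type*} [MeasurableSpace Ω] {μ : Measure Ω}
    [IsProbabilityMeasure μ] {X : Ω → ℝ} (hX : MemLp X 2 μ) : ∫ ω, X ω ∂μ ≤ √(∫ ω, X ω ^ 2 ∂μ) := by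
  have hvar := ProbabilityTheory.variance_nonneg X μ
  rw [ProbabilityTheory.variance_eq_sub hX, sub_nonneg] at hvar
  exact Real.le_sqrt_of_sq_le hvar

theorem exists_integral_norm_trace_le {n K : ℕ} [NeZero n] {κ : Type*} [Fintype κ] [DecidableEq κ]
    [Nontrivial κ] {M : UnitaryGrp n →* Matrix κ κ ℂ} (hM : ∀ a b, Continuous fun u => M u a b)
    (hirr : MatrixIrreducible M) (hχ : (fun u => (M u).trace) ∈ polyDeg n K) {Ω : Type*}
    [TopologicalSpace Ω] [CompactSpace Ω] [MeasurableSpace Ω] [OpensMeasurableSpace Ω]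
    (μ : Measure Ω) [IsFiniteMeasureOnCompacts μ] {U : Ω → UnitaryGrp n} (hU : Continuous U) :
    ∃ k, 0 < k ∧ k ≤ K ∧ ∀ B : ℝ, (∀ a b, ∫ ω, ‖U ω a b‖ ^ k ∂μ ≤ B) →
      ∫ ω, ‖(M (U ω)).trace‖ ∂μ ≤ (n : ℝ) ^ k * (k : ℝ) ^ (2 * k) * B := by
  obtain ⟨k, hk0, hkK, htrace⟩ := exists_norm_trace_le_sum_repeatedValued hM hirr hχ
  refine ⟨k, hk0, hkK, fun B hB => ?_⟩
  have : Nonempty (Fin k) := ⟨⟨0, hk0⟩⟩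
  have hentry (a b : Fin n) : Continuous fun ω => ‖U ω a b‖ :=
    ((UnitaryGrp.continuous_apply a b).comp hU).norm
  have hprod (f : Fin k ⊕ Fin k → Fin n) :
      Integrable (fun ω => ∏ q, ‖U ω (f (Sum.inr q)) (f (Sum.inl q))‖) μ :=
    integrable_of_continuous (continuous_finsetProd _ fun q _ => hentry _ _)
  have hB0 : 0 ≤ B := (integral_nonneg fun ω => by positivity).trans (hB 0 0)
  calc ∫ ω, ‖(M (U ω)).trace‖ ∂μ
      ≤ ∫ ω, ∑ f ∈ repeatedValued (Fin k ⊕ Fin k) (Fin n),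
          ∏ q, ‖U ω (f (Sum.inr q)) (f (Sum.inl q))‖ ∂μ :=
        integral_mono_of_nonneg (.of_forall fun ω => norm_nonneg _)
          (integrable_finsetSum _ fun f _ => hprod f) (.of_forall fun ω => htrace (U ω))
    _ = ∑ f ∈ repeatedValued (Fin k ⊕ Fin k) (Fin n),
          ∫ ω, ∏ q, ‖U ω (f (Sum.inr q)) (f (Sum.inl q))‖ ∂μ :=
        integral_finsetSum _ fun f _ => hprod f
    _ ≤ ∑ _f ∈ repeatedValued (Fin k ⊕ Fin k) (Fin n), B := by
        refine Finset.sum_le_sum fun f _ => integral_prod_le_of_integral_pow_card_le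
          (fun q ω => norm_nonneg _) (fun q => integrable_of_continuous ((hentry _ _).pow _))
          fun q => ?_
        simpa only [Fintype.card_fin] using hB _ _
    _ = (repeatedValued (Fin k ⊕ Fin k) (Fin n)).card * B := by
        rw [Finset.sum_const, nsmul_eq_mul]
    _ ≤ (n : ℝ) ^ k * (k : ℝ) ^ (2 * k) * B := by
        gcongr
        have hcard := card_repeatedValued_le (β := Fin k ⊕ Fin k) (γ := Fin n) (m := k)
          (by simp [two_mul])
        simp only [Fintype.card_sum, Fintype.card_fin, ← two_mul] at hcard
        exact_mod_cast hcard

theorem word_moment_bound_le {n : ℕ} [NeZero n] (k L : ℕ) :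
    (n : ℝ) ^ (k * L) * ((k * L + 2 : ℕ) : ℝ) ^ (2 * k * (L + 2)) *
        ((k * (L + 1)).factorial / (n : ℝ) ^ (k * (L + 1))) ≤
      ((k * (L + 1) + 2 : ℕ) : ℝ) ^ (k * (3 * L + 5)) / (n : ℝ) ^ k := by
  have hn : (n : ℝ) ≠ 0 := NeZero.ne _
  have hfact : ((k * (L + 1)).factorial : ℝ) ≤ ((k * (L + 1) + 2 : ℕ) : ℝ) ^ (k * (L + 1)) := by
    exact_mod_cast (Nat.factorial_le_pow _).trans (Nat.pow_le_pow_left (by omega) _)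
  calc _ = ((k * L + 2 : ℕ) : ℝ) ^ (2 * k * (L + 2)) * (k * (L + 1)).factorial / (n : ℝ) ^ k := by
        rw [mul_add k L 1, mul_one, pow_add]
        field_simp
    _ ≤ ((k * (L + 1) + 2 : ℕ) : ℝ) ^ (2 * k * (L + 2)) *
          ((k * (L + 1) + 2 : ℕ) : ℝ) ^ (k * (L + 1)) / (n : ℝ) ^ k := by
        gcongr
        omega
    _ = ((k * (L + 1) + 2 : ℕ) : ℝ) ^ (k * (3 * L + 5)) / (n : ℝ) ^ k := by
        rw [← pow_add]
        ring_nf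

variable {ι : Type*} [Fintype ι] {n L : ℕ} [NeZero n] {l : Fin (L + 1) → ι × Bool}

omit [Fintype ι] [NeZero n] in
theorem continuous_word (l : Fin (L + 1) → ι × Bool) :
    Continuous fun g : ι → UnitaryGrp n => (List.ofFn fun k => letterVal g (l k)).prod := by
  simp only [List.ofFn_eq_map]
  exact continuous_list_prod _ fun k _ => continuous_letterVal (l k)

theorem integral_norm_word_apply_pow_le_sqrt (k : ℕ) (hl : FreeGroup.IsReduced (List.ofFn l))
    (a b : Fin n) :
    ∫ g, ‖(List.ofFn fun k => letterVal g (l k)).prod a b‖ ^ k ∂haarPi ι n ≤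
      ((k * (L + 1) + 2 : ℕ) : ℝ) ^ (k * (3 * L + 5)) / √n ^ k := by
  have hcont : Continuous fun g : ι → UnitaryGrp n =>
      ‖(List.ofFn fun k => letterVal g (l k)).prod a b‖ ^ k :=
    (((UnitaryGrp.continuous_apply a b).comp (continuous_word l)).norm).pow k
  have hN : (1 : ℝ) ≤ ((k * (L + 1) + 2 : ℕ) : ℝ) := by exact_mod_cast (by omega)
  refine (integral_le_sqrt_integral_sq ((memLp_two_iff_integrable_sq
    hcont.aestronglyMeasurable).mpr (integrable_of_continuous (hcont.pow 2)))).trans ?_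
  refine Real.sqrt_le_iff.mpr ⟨by positivity, ?_⟩
  simp only [← pow_mul, mul_comm _ 2]
  refine (integral_norm_word_apply_pow_le k hl a b).trans ((word_moment_bound_le k L).trans ?_)
  rw [div_pow, pow_right_comm √(n : ℝ), Real.sq_sqrt n.cast_nonneg]
  gcongr
  exact le_self_pow₀ (one_le_pow₀ hN) two_ne_zero

theorem integral_norm_trace_word_le {κ : Type*} [Fintype κ] [DecidableEq κ] [Nontrivial κ]
    {M : UnitaryGrp n →* Matrix κ κ ℂ} (hM : ∀ a b, Continuous fun u => M u a b)
    (hirr : MatrixIrreducible M) {K : ℕ} (hχ : (fun u => (M u).trace) ∈ polyDeg n K)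
    (hl : FreeGroup.IsReduced (List.ofFn l)) :
    0 < K ∧ ∫ g, ‖(M (List.ofFn fun k => letterVal g (l k)).prod).trace‖ ∂haarPi ι n ≤
      (√n * ((K * (L + 1) + 2 : ℕ) : ℝ) ^ (3 * L + 7)) ^ K := by
  obtain ⟨k, hk0, hkK, htrace⟩ :=
    exists_integral_norm_trace_le hM hirr hχ (haarPi ι n) (continuous_word l)
  refine ⟨hk0.trans_le hkK, (htrace _ (integral_norm_word_apply_pow_le_sqrt k hl)).trans ?_⟩
  set N : ℝ := ((k * (L + 1) + 2 : ℕ) : ℝ)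
  have hs1 : 1 ≤ √(n : ℝ) := Real.one_le_sqrt.mpr (Nat.one_le_cast.mpr NeZero.one_le)
  have hsn : (n : ℝ) ^ k = √n ^ k * √n ^ k := by
    rw [← mul_pow, Real.mul_self_sqrt n.cast_nonneg]
  have hkN : (k : ℝ) ≤ N := Nat.cast_le.mpr (by nlinarith)
  have hNK : N ≤ ((K * (L + 1) + 2 : ℕ) : ℝ) := Nat.cast_le.mpr (by gcongr)
  have hN1 : (1 : ℝ) ≤ ((K * (L + 1) + 2 : ℕ) : ℝ) := Nat.one_le_cast.mpr (by omega)
  calc (n : ℝ) ^ k * (k : ℝ) ^ (2 * k) * (N ^ (k * (3 * L + 5)) / √n ^ k)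
      ≤ (n : ℝ) ^ k * N ^ (2 * k) * (N ^ (k * (3 * L + 5)) / √n ^ k) := by gcongr
    _ = (√n * N ^ (3 * L + 7)) ^ k := by
        rw [hsn]
        field_simp
        ring
    _ ≤ (√n * ((K * (L + 1) + 2 : ℕ) : ℝ) ^ (3 * L + 7)) ^ k := by gcongr
    _ ≤ (√n * ((K * (L + 1) + 2 : ℕ) : ℝ) ^ (3 * L + 7)) ^ K :=
        pow_le_pow_right₀ (one_le_mul_of_one_le_of_one_le hs1 (one_le_pow₀ hN1)) hkK

end WordTrace

/-! ### The choice of constants -/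

section Constants

theorem div_pow_le_choose {n K : ℕ} (h : 2 * K ≤ n) :
    ((n : ℝ) / (2 * K)) ^ K ≤ n.choose K := by
  refine le_trans ?_ (Nat.pow_le_choose K n)
  have hhalf : (n : ℝ) / 2 ≤ ((n + 1 - K : ℕ) : ℝ) := by
    rw [Nat.cast_sub (by omega)]
    have : (2 * K : ℝ) ≤ n := by exact_mod_cast h
    push_cast
    linarith
  have hfact : (K.factorial : ℝ) ≤ (K : ℝ) ^ K := by exact_mod_cast Nat.factorial_le_pow K
  rw [← div_div, div_pow]
  gcongr

theorem pow_le_choose_rpow {n K : ℕ} (h : 2 * K ≤ n) {B : ℝ} (hB0 : 0 ≤ B)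
    (hB : B ^ 4 ≤ ((n : ℝ) / (2 * K)) ^ 3) : B ^ K ≤ (n.choose K : ℝ) ^ (3 / 4 : ℝ) := by
  have hpow : (B ^ K) ^ 4 ≤ (n.choose K : ℝ) ^ 3 := by
    calc (B ^ K) ^ 4 = (B ^ 4) ^ K := pow_right_comm _ _ _
      _ ≤ (((n : ℝ) / (2 * K)) ^ 3) ^ K := by gcongr
      _ = (((n : ℝ) / (2 * K)) ^ K) ^ 3 := pow_right_comm _ _ _
      _ ≤ (n.choose K : ℝ) ^ 3 := by
        gcongr
        exact div_pow_le_choose h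
  calc B ^ K = ((B ^ K) ^ 4) ^ (1 / 4 : ℝ) := by
        rw [← Real.rpow_natCast (B ^ K) 4, ← Real.rpow_mul (by positivity)]
        norm_num
    _ ≤ ((n.choose K : ℝ) ^ 3) ^ (1 / 4 : ℝ) := by gcongr
    _ = (n.choose K : ℝ) ^ (3 / 4 : ℝ) := by
        rw [← Real.rpow_natCast _ 3, ← Real.rpow_mul (by positivity)]
        norm_num

theorem trace_bound_le_choose_rpow {n K L : ℕ} (hK : 0 < K)
    (hn : (K * (L + 1) + 2) ^ (12 * L + 34) ≤ n) :
    (√n * ((K * (L + 1) + 2 : ℕ) : ℝ) ^ (3 * L + 7)) ^ K ≤ (n.choose K : ℝ) ^ (3 / 4 : ℝ) := by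
  set N := K * (L + 1) + 2
  have hKN₀ : K + 2 ≤ N := Nat.add_le_add_right (Nat.le_mul_of_pos_right _ L.succ_pos) _
  have hKN : 2 * K ≤ N ^ 2 := by nlinarith
  have hNn : N ^ 2 ≤ n := (Nat.pow_le_pow_right (by omega) (by omega)).trans hn
  refine pow_le_choose_rpow (hKN.trans hNn) (by positivity) ?_
  have : (0 : ℝ) < K := Nat.cast_pos.mpr hK
  have hKN' : (2 * K : ℝ) ≤ (N : ℝ) ^ 2 := by exact_mod_cast hKN
  have hn' : (N : ℝ) ^ (12 * L + 34) ≤ n := by exact_mod_cast hn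
  have hsqrt : √(n : ℝ) ^ 4 = (n : ℝ) ^ 2 := by
    rw [show 4 = 2 * 2 from rfl, pow_mul, Real.sq_sqrt n.cast_nonneg]
  rw [mul_pow, hsqrt, div_pow, le_div_iff₀ (by positivity)]
  calc (n : ℝ) ^ 2 * ((N : ℝ) ^ (3 * L + 7)) ^ 4 * (2 * K) ^ 3
      ≤ (n : ℝ) ^ 2 * ((N : ℝ) ^ (3 * L + 7)) ^ 4 * ((N : ℝ) ^ 2) ^ 3 := by gcongr
    _ = (n : ℝ) ^ 2 * (N : ℝ) ^ (12 * L + 34) := by ring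
    _ ≤ (n : ℝ) ^ 2 * n := by gcongr
    _ = (n : ℝ) ^ 3 := by ring

theorem mul_log_pow_le_of_le_two_rpow {d n c m : ℕ} (hd : d ≠ 0) (hc : 0 < c) (hm : m ≠ 0)
    (h : (d : ℝ) ≤ 2 ^ (1 / c * (n : ℝ) ^ (1 / m : ℝ))) : (c * Nat.log 2 d) ^ m ≤ n := by
  have hlog : (2 : ℝ) ^ (Nat.log 2 d : ℝ) ≤ 2 ^ (1 / c * (n : ℝ) ^ (1 / m : ℝ)) := by
    refine le_trans ?_ h
    rw [Real.rpow_natCast]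
    exact_mod_cast Nat.pow_log_le_self 2 hd
  have hc' : (0 : ℝ) < c := Nat.cast_pos.mpr hc
  have hle := (Real.rpow_le_rpow_left_iff one_lt_two).mp hlog
  rw [one_div_mul_eq_div, le_div_iff₀' hc'] at hle
  have hpow := pow_le_pow_left₀ (by positivity) hle m
  rw [one_div, Real.rpow_inv_natCast_pow n.cast_nonneg hm] at hpow
  exact_mod_cast hpow

end Constants

section Main

theorem integral_norm_trace_word_le_card_rpow {ι κ : Type*} [Fintype ι] [Fintype κ] [DecidableEq κ]
    [Nontrivial κ] {n L q : ℕ} {l : Fin (L + 1) → ι × Bool}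
    (hl : FreeGroup.IsReduced (List.ofFn l)) {M : UnitaryGrp n →* Matrix κ κ ℂ}
    (hM : ∀ a b, Continuous fun u => M u a b) (hirr : MatrixIrreducible M)
    (hq : Fintype.card κ < 2 ^ (q + 1)) (hn : (2 * q * (L + 1) + 2) ^ (12 * L + 34) ≤ n) :
    ∫ g, ‖(M (List.ofFn fun k => letterVal g (l k)).prod).trace‖ ∂haarPi ι n ≤
      (Fintype.card κ : ℝ) ^ (3 / 4 : ℝ) := by
  have hqn : 4 * q + 1 < n := by
    have hle : (2 * q * (L + 1) + 2) ^ 2 ≤ n :=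
      (Nat.pow_le_pow_right (by omega) (by omega)).trans hn
    have hlin : 2 * q + 2 ≤ 2 * q * (L + 1) + 2 :=
      Nat.add_le_add_right (Nat.le_mul_of_pos_right _ L.succ_pos) _
    nlinarith
  have : NeZero n := ⟨by omega⟩
  obtain ⟨K, b, hKq, hchoose, hχ⟩ := exists_detTwist_mem_polyDeg hM hirr hq hqn
  obtain ⟨hK, hbound⟩ :=
    integral_norm_trace_word_le (continuous_detTwist_apply hM b) (hirr.detTwist b) hχ hl
  simp only [norm_trace_detTwist] at hbound
  calc _ ≤ _ := hbound
    _ ≤ (n.choose K : ℝ) ^ (3 / 4 : ℝ) :=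
      trace_bound_le_choose_rpow hK ((Nat.pow_le_pow_left (by gcongr) _).trans hn)
    _ ≤ (Fintype.card κ : ℝ) ^ (3 / 4 : ℝ) := by gcongr

theorem exists_toWord_eq_ofFn {α : Type*} [DecidableEq α] {w : FreeGroup α} (hw : w ≠ 1) :
    ∃ (L : ℕ) (l : Fin (L + 1) → α × Bool), w.toWord = List.ofFn l := by
  have hlen : w.toWord.length ≠ 0 := by simpa using hw
  obtain ⟨L, hL⟩ := Nat.exists_eq_succ_of_ne_zero hlen
  exact ⟨L, fun k => w.toWord.get (k.cast hL.symm), (List.ofFn_get _).symm.trans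
    (List.ofFn_congr hL _)⟩

theorem wordMap_eq_prod_ofFn {r m : ℕ} {w : FreeGroup (Fin r)} {l : Fin m → Fin r × Bool}
    (hw : w.toWord = List.ofFn l) {G : Type*} [Group G] (g : Fin r → G) :
    wordMap w g = (List.ofFn fun k => letterVal g (l k)).prod := by
  rw [wordMap, ← FreeGroup.mk_toWord (x := w), FreeGroup.lift_mk, hw, List.map_ofFn]
  rfl

theorem exists_matrixIrreducible_of_mem_Irr {n : ℕ} {ρ : UnitaryGrp n → ℂ}
    (hρ : ρ ∈ Irr (UnitaryGrp n)) :
    ∃ (d : ℕ) (M : UnitaryGrp n →* Matrix (Fin d) (Fin d) ℂ), 0 < d ∧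
      (∀ a b, Continuous fun u => M u a b) ∧ MatrixIrreducible M ∧ ∀ u, ρ u = (M u).trace := by
  obtain ⟨d, π, hc, hirr, rfl⟩ := hρ
  let M : UnitaryGrp n →* Matrix (Fin d) (Fin d) ℂ :=
    (LinearMap.toMatrixAlgEquiv' (R := ℂ) (n := Fin d) : _ →* _).comp π
  have hMv (u v) : (M u).mulVec v = π u v := LinearMap.toMatrix'_mulVec _ _
  refine ⟨d, M, ?_, fun a b => ?_, fun W hW => ?_, fun u => ?_⟩
  · rw [Nat.pos_iff_ne_zero]
    rintro rfl
    obtain ⟨A, B, hAB⟩ := hirr.exists_pair_ne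
    exact hAB (Subrepresentation.toSubmodule_injective (Subsingleton.elim _ _))
  · have happly (u) : M u a b = π u (Pi.single b 1) a := by
      rw [← hMv, Matrix.mulVec_single_one]
      rfl
    simp only [happly]
    exact (continuous_apply a).comp (hc _)
  · have h := hirr.eq_bot_or_eq_top ⟨W, fun g v hv => by rw [← hMv]; exact hW g v hv⟩
    exact h.imp (congrArg Subrepresentation.toSubmodule) (congrArg Subrepresentation.toSubmodule)
  · exact (LinearMap.trace_eq_matrix_trace ℂ (Pi.basisFun ℂ (Fin d)) (π u))

theorem mainTheorem8_general (r : ℕ) (w : FreeGroup (Fin r)) (hw : w ≠ 1) :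
    ∃ C α : ℝ, 0 < C ∧ 0 < α ∧ ∀ (n : ℕ), ∀ ρ ∈ Irr (UnitaryGrp n),
      (ρ 1).re ≤ (2 : ℝ) ^ (C * (n : ℝ) ^ α) →
        ∫ g, ‖ρ (wordMap w g)‖ ∂haarPi (Fin r) n ≤ (ρ 1).re ^ (3 / 4 : ℝ) := by
  obtain ⟨L, l, hl⟩ := exists_toWord_eq_ofFn hw
  refine ⟨1 / (4 * (L + 1) : ℕ), 1 / (12 * L + 34 : ℕ), by positivity, by positivity,
    fun n ρ hρ hdim => ?_⟩
  obtain ⟨d, M, hd, hM, hirr, htr⟩ := exists_matrixIrreducible_of_mem_Irr hρ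
  simp only [htr, wordMap_eq_prod_ofFn hl, map_one, Matrix.trace_one, Fintype.card_fin,
    Complex.natCast_re] at hdim ⊢
  rcases hd.nat_succ_le.eq_or_lt with rfl | hd1
  · rw [Nat.cast_one, Real.one_rpow]
    refine (Real.le_norm_self _).trans
      ((norm_integral_le_of_norm_le_const (C := 1) (.of_forall fun g => ?_)).trans (by simp))
    rw [norm_norm]
    exact (norm_trace_le_card hM _).trans_eq (by simp)
  · have : Nontrivial (Fin d) := Fin.nontrivial_iff_two_le.mpr hd1
    have hlog : 1 ≤ Nat.log 2 d := Nat.log_pos one_lt_two hd1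
    have hn := mul_log_pow_le_of_le_two_rpow hd.ne' (by positivity) (by omega) hdim
    have hbound := integral_norm_trace_word_le_card_rpow (hl ▸ FreeGroup.isReduced_toWord) hM hirr
      (by simpa using Nat.lt_pow_succ_log_self one_lt_two d)
      ((Nat.pow_le_pow_left (by nlinarith) _).trans hn)
    rwa [Fintype.card_fin] at hbound

end Main

theorem mainTheorem8 (r : ℕ) (w : FreeGroup (Fin r)) (hw : w ≠ 1) :
    ∃ C α ε : ℝ, 0 < C ∧ 0 < α ∧ 0 < ε ∧
      ∀ (n : ℕ), ∀ ρ ∈ Irr (UnitaryGrp n),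
        (ρ 1).re ≤ (2 : ℝ) ^ (C * (n : ℝ) ^ α) →
          ‖wordExpectation w n ρ‖ ≤ (ρ 1).re ^ (1 - ε) := by
  obtain ⟨C, α, hC, hα, h⟩ := mainTheorem8_general r w hw
  refine ⟨C, α, 1 / 4, hC, hα, by norm_num, fun n ρ hρ hdim => ?_⟩
  refine (norm_integral_le_integral_norm _).trans ((h n ρ hρ hdim).trans_eq ?_)
  norm_num
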